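/- Let $K\subset\mathbb{C}$ be a CM field, finite and Galois over $\mathbb{Q}$, let $G=\mathrm{Gal}(K/\mathbb{Q})$, let $\iota\in G$ be complex conjugation, and let $2m=[K:\mathbb{Q}]$. Abelian varieties over $\mathbb{C}$ are regarded as polarizable complex tori. An abelian variety $A$ over $\mathbb{C}$ is a CM abelian variety if $\mathrm{End}^0(A)=\mathrm{End}(A)\otimes\mathbb{Q}$ contains an étale $\mathbb{Q}$-subalgebra of degree $2\dim A$, and $A$ is split by $K$ if $\mathrm{End}^0(A)\otimes_{\mathbb{Q}}K$ is isomorphic, as a $K$-algebra, to a finite product of matrix algebras over $K$. *The variety $A(S,S^+)$.* Let $S$ be a finite left $G$-set and $S^+$ a subset such that $S=S^+\sqcup\iota S^+$. Let $E=\mathrm{Hom}(S,K)^G$ be the $\mathbb{Q}$-algebra of $G$-equivariant maps $S\to K$, embedded in $\mathbb{C}^{S^+}$ by $f\mapsto (f(s))_{s\in S^+}$. Then $A(S,S^+)$ denotes the quotient of $\mathbb{C}^{S^+}$ by any lattice in $E$ (the subgroup generated by a $\mathbb{Q}$-basis of $E$). *The variety $A(G,K,\rho)$.* Let $R(2^m)$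 be the set of connected regions into which the coordinate hyperplanes $x_i=0$ $(1\le i\le m)$ divide $\mathbb{R}^m$, and let $R(2^m)^+$ be the set of those on which $x_1>0$. For a faithful linear representation $\rho$ of $G$ on $\mathbb{R}^m$ that permutes the coordinate hyperplanes transitively and has $\rho(\iota)=-1$, the group $G$ acts on $R(2^m)$ through $\rho$, and $A(G,K,\rho)=A(R(2^m),R(2^m)^+)$. *The representation $\rho_\Phi$.* Let $\Phi=\{\varphi_1,\dots,\varphi_m\}\subset G=\mathrm{Hom}(K,\mathbb{C})$ be a CM-type on $K$ (for each $g\in G$, exactly one of $g,\iota g$ is in $\Phi$), with any numbering of its elements. For $g\in G$, write $$\varphi_i\circ g=\iota^{e(\varepsilon_i)}\circ\varphi_{\sigma^{-1}(i)},\qquad e(+)=0,\ e(-)=1,\qquad 1\le i\le m,$$ with $\varepsilon=(\varepsilon_i)\in\{\pm\}^m$ and $\sigma\in S_m$. Then $g\mapsto(\varepsilon,\sigma)$ is a homomorphism $G\to\{\pm\}^m\rtimes S_m$, and $\rho_\Phi$ is its composite with the action $((\varepsilon,\sigma)x)_i=\varepsilon_i x_{\sigma^{-1}(i)}$ of $\{\pm\}^m\rtimes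 S_m$ on $\mathbb{R}^m$. **Proposition.** For every $K$ and $\Phi$ as above, and for every choice of the lattice in its definition, $A(G,K,\rho_\Phi)$ is an abelian variety, and every simple CM abelian variety over $\mathbb{C}$ split by $K$ is isogenous to an abelian subvariety of $A(G,K,\rho_\Phi)$. -/

import Mathlib

open scoped TensorProduct

noncomputable section

namespace CMArrangement

/-! ### Complex abelian varieties as polarizable complex tori

The complex torus `V / Λ` is given by a complex vector space `V` and a subgroup `Λ` of `V`. -/

/-- `L` is a (full) lattice in the `k`-vector space `V`, where `k` is `ℚ` or `ℝ`: it is the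
subgroup generated by a `k`-basis of `V`. In particular `V` is finite dimensional. -/
def IsLattice (k : Type*) [Field k] {V : Type*} [AddCommGroup V] [Module k V]
    (L : Submodule ℤ V) : Prop :=
  ∃ (n : ℕ) (b : Module.Basis (Fin n) k V), L = Submodule.span ℤ (Set.range b)

section Tori

variable {V : Type*} [AddCommGroup V] [Module ℂ V]
variable {V' : Type*} [AddCommGroup V'] [Module ℂ V']

/-- `E` is a Riemann form (a polarization) on `V / Λ`: an alternating real bilinear form, integral
on `Λ`, invariant under multiplication by `i`, and such that `E x (i x)` is positive definite. -/
structure IsRiemannForm (Λ : Submodule ℤ V) (E : V →ₗ[ℝ] V →ₗ[ℝ] ℝ) : Prop where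
  alternating : ∀ x, E x x = 0
  integral : ∀ x ∈ Λ, ∀ y ∈ Λ, ∃ n : ℤ, E x y = n
  invariant : ∀ x y, E (Complex.I • x) (Complex.I • y) = E x y
  pos : ∀ x, x ≠ 0 → 0 < E x (Complex.I • x)

/-- `V / Λ` is an abelian variety over `ℂ`: `Λ` is a lattice in the real vector space underlying
`V`, and the complex torus `V / Λ` is polarizable. -/
structure IsAbelianVariety (Λ : Submodule ℤ V) : Prop where
  isLattice : IsLattice ℝ Λ
  polarizable : ∃ E : V →ₗ[ℝ] V →ₗ[ℝ] ℝ, IsRiemannForm Λ E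

/-- The lattice `W ∩ Λ` of the subtorus of `V / Λ` with tangent space `W`. -/
def subLattice (Λ : Submodule ℤ V) (W : Submodule ℂ V) : Submodule ℤ W :=
  Λ.comap (W.subtype.restrictScalars ℤ)

/-- The image of `W` in `V / Λ` is an abelian subvariety: `W / (W ∩ Λ)` is again an abelian
variety. -/
def IsAbelianSubvariety (Λ : Submodule ℤ V) (W : Submodule ℂ V) : Prop :=
  IsAbelianVariety (subLattice Λ W)

/-- `V / Λ` is simple: it is nonzero, and has no abelian subvarieties but `0` and itself. -/
def IsSimple (Λ : Submodule ℤ V) : Prop :=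
  Nontrivial V ∧ ∀ W : Submodule ℂ V, IsAbelianSubvariety Λ W → W = ⊥ ∨ W = ⊤

/-- There is an isogeny `V / Λ → V' / Λ'`: a homomorphism (the map induced by a `ℂ`-linear map
`f : V → V'` with `f Λ ⊆ Λ'`) which is surjective and has finite kernel. -/
def Isogenous (Λ : Submodule ℤ V) (Λ' : Submodule ℤ V') : Prop :=
  ∃ (f : V →ₗ[ℂ] V') (h : Λ ≤ Λ'.comap (f.restrictScalars ℤ)),
    Function.Surjective (Λ.mapQ Λ' (f.restrictScalars ℤ) h) ∧
      Finite (LinearMap.ker (Λ.mapQ Λ' (f.restrictScalars ℤ) h))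

/-- The endomorphism ring `End(V / Λ)`. -/
def endRing (Λ : Submodule ℤ V) : Subring (Module.End ℂ V) where
  carrier := {f | ∀ x ∈ Λ, f x ∈ Λ}
  mul_mem' hf hg x hx := hf _ (hg x hx)
  one_mem' _ hx := hx
  add_mem' hf hg x hx := Λ.add_mem (hf x hx) (hg x hx)
  zero_mem' _ _ := Λ.zero_mem
  neg_mem' hf x hx := Λ.neg_mem (hf x hx)

/-- The endomorphism algebra `End⁰(V / Λ) = End(V / Λ) ⊗ ℚ`. -/
abbrev EndAlg (Λ : Submodule ℤ V) : Type _ := ℚ ⊗[ℤ] endRing Λ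

/-- `V / Λ` is a CM abelian variety: its endomorphism algebra contains an étale `ℚ`-subalgebra of
degree `2 dim (V / Λ)`. -/
def IsCM (Λ : Submodule ℤ V) : Prop :=
  ∃ (E : Type) (_ : CommRing E) (_ : Algebra ℚ E),
    Algebra.Etale ℚ E ∧ Module.finrank ℚ E = 2 * Module.finrank ℂ V ∧
      ∃ i : E →ₐ[ℚ] EndAlg Λ, Function.Injective i

/-- `V / Λ` is split by `K`: the `K`-algebra `End⁰(V / Λ) ⊗ K` is isomorphic to a finite product of
matrix algebras over `K`. -/
def IsSplitBy (K : Type*) [Field K] [Algebra ℚ K] (Λ : Submodule ℤ V) : Prop :=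
  ∃ (r : ℕ) (n : Fin r → ℕ),
    Nonempty (K ⊗[ℚ] EndAlg Λ ≃ₐ[K] ((j : Fin r) → Matrix (Fin (n j)) (Fin (n j)) K))

end Tori

/-! ### The abelian variety `A(S, S⁺)` -/

section Pairs

variable (K : IntermediateField ℚ ℂ) (S : Type*) [MulAction Gal(K/ℚ) S]

/-- The `ℚ`-algebra `E = Hom(S, K)^G` of `G`-equivariant maps `S → K`, where `G = Gal(K/ℚ)`. -/
def equivariantMaps : Subalgebra ℚ (S → K) where
  carrier := {f | ∀ (g : Gal(K/ℚ)) (s : S), f (g • s) = g (f s)}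
  mul_mem' hf hg g s := by simp [hf g s, hg g s]
  add_mem' hf hg g s := by simp [hf g s, hg g s]
  algebraMap_mem' r g s := by simp

variable {K S}

/-- The map `E → ℂ^{S⁺}`, `f ↦ (f s)_{s ∈ S⁺}`. (The element `s` of `S` corresponds to the
homomorphism `f ↦ f s` from `E` to `K`.) -/
def evalPos (Splus : Set S) : equivariantMaps K S →ₗ[ℤ] (Splus → ℂ) where
  toFun f s := (f.1 s.1 : ℂ)
  map_add' f g := by ext s; simp
  map_smul' n f := by ext s; simp

/-- The image in `ℂ^{S⁺}` of a lattice `L` in `E`. The torus `ℂ^{S⁺} / (image of L)` is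
`A(S, S⁺)`; it is defined up to isogeny, because of the choice of `L`. -/
def pairLattice (Splus : Set S) (L : Submodule ℤ (equivariantMaps K S)) :
    Submodule ℤ (Splus → ℂ) :=
  L.map (evalPos Splus)

end Pairs

/-! ### The arrangement of the coordinate hyperplanes, and `A(G, K, ρ)` -/

/-- The coordinate hyperplane `x_i = 0` in `ℝ^m`. -/
def coordHyperplane {m : ℕ} (i : Fin m) : Set (Fin m → ℝ) := {x | x i = 0}

/-- The complement in `ℝ^m` of the union of the coordinate hyperplanes. -/
def arrangementCompl (m : ℕ) : Set (Fin m → ℝ) := (⋃ i : Fin m, coordHyperplane i)ᶜ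

/-- `R` is a connected region of the arrangement. -/
def IsRegion {m : ℕ} (R : Set (Fin m → ℝ)) : Prop :=
  ∃ x ∈ arrangementCompl m, R = connectedComponentIn (arrangementCompl m) x

section CMField

variable (K : IntermediateField ℚ ℂ) [FiniteDimensional ℚ K] [NumberField.IsCMField K]

/-- Complex conjugation `ι` on the CM field `K`, as an element of `G = Gal(K/ℚ)`. -/
def conj : Gal(K/ℚ) := (NumberField.IsCMField.complexConj K).restrictScalars ℚ

theorem coe_conj (x : K) : ((conj K x : K) : ℂ) = (starRingEnd ℂ) (x : ℂ) :=
  NumberField.IsCMField.complexEmbedding_complexConj K K.val.toRingHom x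

theorem conj_mul_conj : conj K * conj K = 1 := by
  refine AlgEquiv.ext fun x => Subtype.ext ?_
  simp [AlgEquiv.mul_apply, coe_conj]

theorem conj_comm (g : Gal(K/ℚ)) : g * conj K = conj K * g := by
  refine AlgEquiv.ext fun x => ?_
  have h := NumberField.IsCMField.complexEmbedding_complexConj K
    (K.val.toRingHom.comp (g : K →+* K)) x
  exact Subtype.ext (h.trans (coe_conj K (g x)).symm)

/-- A linear representation `ρ` of `G = Gal(K/ℚ)` on `ℝ^m` of the kind considered for the
arrangement of the coordinate hyperplanes: it is faithful, `G` permutes the coordinate hyperplanes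
transitively, and `ρ(ι) = -1`. -/
structure ArrangementRep (m : ℕ) where
  ρ : Representation ℝ Gal(K/ℚ) (Fin m → ℝ)
  faithful : Function.Injective ρ
  permutes : ∀ (g : Gal(K/ℚ)) (i : Fin m), ∃ j : Fin m, ρ g '' coordHyperplane i = coordHyperplane j
  transitive : ∀ i j : Fin m, ∃ g : Gal(K/ℚ), ρ g '' coordHyperplane i = coordHyperplane j
  conj_eq_neg : ρ (conj K) = -1

variable {K} {m : ℕ}

namespace ArrangementRep

variable (r : ArrangementRep K m)

theorem inv_apply (g : Gal(K/ℚ)) (x : Fin m → ℝ) : r.ρ g⁻¹ (r.ρ g x) = x := by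
  rw [← Module.End.mul_apply, ← map_mul]; simp

theorem apply_inv (g : Gal(K/ℚ)) (x : Fin m → ℝ) : r.ρ g (r.ρ g⁻¹ x) = x := by
  rw [← Module.End.mul_apply, ← map_mul]; simp

/-- `ρ g` as a homeomorphism of `ℝ^m`. -/
def homeo (g : Gal(K/ℚ)) : (Fin m → ℝ) ≃ₜ (Fin m → ℝ) where
  toFun := r.ρ g
  invFun := r.ρ g⁻¹
  left_inv := r.inv_apply g
  right_inv := r.apply_inv g
  continuous_toFun := LinearMap.continuous_of_finiteDimensional _
  continuous_invFun := LinearMap.continuous_of_finiteDimensional _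

theorem apply_mem_compl (g : Gal(K/ℚ)) {x : Fin m → ℝ} (hx : x ∈ arrangementCompl m) :
    r.ρ g x ∈ arrangementCompl m := by
  intro h
  obtain ⟨i, hi⟩ := Set.mem_iUnion.1 h
  obtain ⟨j, hj⟩ := r.permutes g⁻¹ i
  refine hx (Set.mem_iUnion.2 ⟨j, ?_⟩)
  rw [← hj]
  exact ⟨_, hi, r.inv_apply g x⟩

theorem image_compl (g : Gal(K/ℚ)) :
    r.homeo g '' arrangementCompl m = arrangementCompl m := by
  apply Set.Subset.antisymm
  · rintro _ ⟨x, hx, rfl⟩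
    exact r.apply_mem_compl g hx
  · intro x hx
    exact ⟨_, r.apply_mem_compl g⁻¹ hx, r.apply_inv g x⟩

theorem isRegion_image (g : Gal(K/ℚ)) {R : Set (Fin m → ℝ)} (hR : IsRegion R) :
    IsRegion (r.ρ g '' R) := by
  obtain ⟨x, hx, rfl⟩ := hR
  refine ⟨r.ρ g x, r.apply_mem_compl g hx, ?_⟩
  have h := (r.homeo g).image_connectedComponentIn hx
  rw [r.image_compl g] at h
  exact h

/-- The set `R(2^m)` of connected regions of the arrangement, on which `G` acts through `ρ`. -/
def Regions (_ : ArrangementRep K m) : Type := {R : Set (Fin m → ℝ) // IsRegion R}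

instance : MulAction Gal(K/ℚ) r.Regions where
  smul g R := ⟨r.ρ g '' R.1, r.isRegion_image g R.2⟩
  one_smul R := Subtype.ext (by
    change r.ρ 1 '' R.1 = R.1
    simp)
  mul_smul g h R := Subtype.ext (by
    change r.ρ (g * h) '' R.1 = r.ρ g '' (r.ρ h '' R.1)
    rw [map_mul, Set.image_image]
    rfl)

/-- The subset `R(2^m)⁺` of those regions on which the first coordinate is positive. -/
def posRegions [NeZero m] : Set r.Regions := {R | ∀ x ∈ R.1, 0 < x 0}

end ArrangementRep

/-! ### The representation `ρ_Φ` attached to a CM-type -/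

variable (K m) in
/-- A CM-type `Φ = {φ_1, …, φ_m}` on `K`, with its elements numbered: for every `g` in
`G = Gal(K/ℚ)`, which is identified with `Hom(K, ℂ)` by means of the inclusion of the Galois
extension `K` of `ℚ` in `ℂ`, exactly one of `g` and `ι ∘ g` belongs to `Φ`. -/
structure NumberedCMType where
  φ : Fin m → Gal(K/ℚ)
  injective : Function.Injective φ
  isCMType : ∀ g : Gal(K/ℚ), Xor (g ∈ Set.range φ) (conj K * g ∈ Set.range φ)

variable (K) in
/-- The homomorphism from `{±}` to `⟨ι⟩` sending `-` to `ι`. -/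
def signConj : ℤˣ →* Gal(K/ℚ) where
  toFun ε := if ε = 1 then 1 else conj K
  map_one' := by simp
  map_mul' a b := by
    rcases Int.units_eq_one_or a with rfl | rfl <;> rcases Int.units_eq_one_or b with rfl | rfl <;>
      simp [conj_mul_conj]

theorem signConj_neg_one : signConj K (-1) = conj K := by
  change (if (-1 : ℤˣ) = 1 then 1 else conj K) = conj K
  exact if_neg (by decide)

/-- The action of `{±}^m ⋊ S_m` on `ℝ^m`, where `S_m` acts on `{±}^m` by
`(σ ε)_i = ε_{σ⁻¹ i}`. It is given by `((ε, σ) x)_i = ε_i x_{σ⁻¹ i}`. -/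
def signedPermRep (m : ℕ) :
    Representation ℝ ((Fin m → ℤˣ) ⋊[mulAutArrow] Equiv.Perm (Fin m)) (Fin m → ℝ) where
  toFun a :=
    { toFun := fun x i => ((a.left i : ℤ) : ℝ) * x (a.right⁻¹ i)
      map_add' := fun x y => by ext i; simp [mul_add]
      map_smul' := fun c x => by ext i; simp [mul_left_comm] }
  map_one' := by ext; simp
  map_mul' a b := by
    refine LinearMap.ext fun x => funext fun i => ?_
    change _ = ((a.left i : ℤ) : ℝ) *
      (((b.left (a.right⁻¹ i) : ℤ) : ℝ) * x (b.right⁻¹ (a.right⁻¹ i)))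
    change (((a.left i * b.left (a.right⁻¹ i) : ℤˣ) : ℤ) : ℝ) * x (b.right⁻¹ (a.right⁻¹ i)) = _
    push_cast
    ring

theorem signedPermRep_apply (a : (Fin m → ℤˣ) ⋊[mulAutArrow] Equiv.Perm (Fin m))
    (x : Fin m → ℝ) (i : Fin m) :
    signedPermRep m a x i = ((a.left i : ℤ) : ℝ) * x (a.right⁻¹ i) := rfl

namespace NumberedCMType

variable (Φ : NumberedCMType K m)

theorem bijective :
    Function.Bijective fun p : ℤˣ × Fin m => signConj K p.1 * Φ.φ p.2 := by
  constructor
  · rintro ⟨a, i⟩ ⟨b, j⟩ h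
    have key : ∀ i j, Φ.φ i ≠ conj K * Φ.φ j := by
      intro i j h
      rcases Φ.isCMType (Φ.φ j) with ⟨_, h2⟩ | ⟨_, h2⟩
      · exact h2 ⟨i, h⟩
      · exact h2 ⟨j, rfl⟩
    rcases Int.units_eq_one_or a with rfl | rfl <;> rcases Int.units_eq_one_or b with rfl | rfl <;>
      simp only [map_one, one_mul, signConj_neg_one] at h
    · rw [Φ.injective h]
    · exact absurd h (key _ _)
    · exact absurd h.symm (key _ _)
    · rw [Φ.injective (mul_left_cancel h)]
  · intro g
    rcases Φ.isCMType g with ⟨⟨i, hi⟩, _⟩ | ⟨⟨i, hi⟩, _⟩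
    · exact ⟨(1, i), by simp [hi]⟩
    · refine ⟨(-1, i), ?_⟩
      simp only [signConj_neg_one, hi, ← mul_assoc, conj_mul_conj, one_mul]

/-- Every `g` in `G` can be written `ι^{e(ε)} ∘ φ_j` for a unique pair `(ε, j)`, where
`e(+) = 0` and `e(-) = 1`. -/
def decomp : ℤˣ × Fin m ≃ Gal(K/ℚ) := Equiv.ofBijective _ Φ.bijective

theorem decomp_apply (p : ℤˣ × Fin m) : Φ.decomp p = signConj K p.1 * Φ.φ p.2 := rfl

theorem decomp_symm_mul (a : ℤˣ) (g : Gal(K/ℚ)) :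
    Φ.decomp.symm (signConj K a * g) = (a * (Φ.decomp.symm g).1, (Φ.decomp.symm g).2) := by
  rw [Equiv.symm_apply_eq, decomp_apply, map_mul, mul_assoc, ← decomp_apply,
    Equiv.apply_symm_apply]

theorem decomp_symm_φ (i : Fin m) : Φ.decomp.symm (Φ.φ i) = (1, i) := by
  rw [Equiv.symm_apply_eq, decomp_apply, map_one, one_mul]

/-- The sign `ε_i` in the equation `φ_i ∘ g = ι^{e(ε_i)} ∘ φ_j`. -/
def sgn (g : Gal(K/ℚ)) (i : Fin m) : ℤˣ := (Φ.decomp.symm (Φ.φ i * g)).1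

/-- The index `j` in the equation `φ_i ∘ g = ι^{e(ε_i)} ∘ φ_j`. -/
def idx (g : Gal(K/ℚ)) (i : Fin m) : Fin m := (Φ.decomp.symm (Φ.φ i * g)).2

theorem φ_mul (g : Gal(K/ℚ)) (i : Fin m) :
    Φ.φ i * g = signConj K (Φ.sgn g i) * Φ.φ (Φ.idx g i) :=
  (Φ.decomp.apply_symm_apply (Φ.φ i * g)).symm

theorem decomp_symm_mul_mul (g h : Gal(K/ℚ)) (i : Fin m) :
    Φ.decomp.symm (Φ.φ i * (g * h)) =
      (Φ.sgn g i * Φ.sgn h (Φ.idx g i), Φ.idx h (Φ.idx g i)) := by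
  rw [← mul_assoc, φ_mul, mul_assoc, decomp_symm_mul]
  rfl

theorem sgn_mul (g h : Gal(K/ℚ)) (i : Fin m) :
    Φ.sgn (g * h) i = Φ.sgn g i * Φ.sgn h (Φ.idx g i) :=
  congrArg Prod.fst (Φ.decomp_symm_mul_mul g h i)

theorem idx_mul (g h : Gal(K/ℚ)) (i : Fin m) : Φ.idx (g * h) i = Φ.idx h (Φ.idx g i) :=
  (congrArg Prod.snd (Φ.decomp_symm_mul_mul g h i) :)

theorem idx_one (i : Fin m) : Φ.idx 1 i = i := by
  rw [idx, mul_one, decomp_symm_φ]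

theorem sgn_one (i : Fin m) : Φ.sgn 1 i = 1 := by
  rw [sgn, mul_one, decomp_symm_φ]

/-- The permutation `σ` such that `φ_i ∘ g = ι^{e(ε_i)} ∘ φ_{σ⁻¹ i}` for all `i`. -/
def perm (g : Gal(K/ℚ)) : Equiv.Perm (Fin m) where
  toFun := Φ.idx g⁻¹
  invFun := Φ.idx g
  left_inv i := by rw [← idx_mul, inv_mul_cancel, idx_one]
  right_inv i := by rw [← idx_mul, mul_inv_cancel, idx_one]

/-- The homomorphism `ρ_Φ : G → {±}^m ⋊ S_m`, `g ↦ ((ε_i)_i, σ)`, where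
`φ_i ∘ g = ι^{e(ε_i)} ∘ φ_{σ⁻¹ i}` for all `i`. -/
def rhoHom : Gal(K/ℚ) →* (Fin m → ℤˣ) ⋊[mulAutArrow] Equiv.Perm (Fin m) where
  toFun g := ⟨Φ.sgn g, Φ.perm g⟩
  map_one' := by
    apply SemidirectProduct.ext
    · funext i; exact Φ.sgn_one i
    · ext i; simp [perm, idx_one]
  map_mul' g h := by
    apply SemidirectProduct.ext
    · funext i; exact Φ.sgn_mul g h i
    · refine Equiv.ext fun i => ?_
      change Φ.idx (g * h)⁻¹ i = Φ.idx g⁻¹ (Φ.idx h⁻¹ i)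
      rw [mul_inv_rev, idx_mul]

theorem rhoHom_spec (g : Gal(K/ℚ)) (i : Fin m) :
    Φ.φ i * g = signConj K ((Φ.rhoHom g).left i) * Φ.φ ((Φ.rhoHom g).right⁻¹ i) :=
  Φ.φ_mul g i

theorem rep_apply (g : Gal(K/ℚ)) (x : Fin m → ℝ) (i : Fin m) :
    (signedPermRep m).comp Φ.rhoHom g x i = ((Φ.sgn g i : ℤ) : ℝ) * x (Φ.idx g i) := rfl

theorem sgn_ne_zero (g : Gal(K/ℚ)) (i : Fin m) : ((Φ.sgn g i : ℤ) : ℝ) ≠ 0 := by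
  exact_mod_cast (Φ.sgn g i).ne_zero

theorem image_hyperplane (g : Gal(K/ℚ)) (i j : Fin m) (h : Φ.idx g j = i) :
    (signedPermRep m).comp Φ.rhoHom g '' coordHyperplane i = coordHyperplane j := by
  apply Set.Subset.antisymm
  · rintro _ ⟨x, hx, rfl⟩
    change _ = _
    rw [rep_apply, h, show x i = 0 from hx, mul_zero]
  · intro y hy
    refine ⟨(signedPermRep m).comp Φ.rhoHom g⁻¹ y, ?_, ?_⟩
    · change _ = _
      rw [rep_apply, ← h, ← idx_mul, mul_inv_cancel, idx_one, show y j = 0 from hy, mul_zero]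
    · rw [← Module.End.mul_apply, ← map_mul]; simp

/-- The linear representation `ρ_Φ` of `G` on `ℝ^m`: the composite of `ρ_Φ : G → {±}^m ⋊ S_m` with
the natural action of `{±}^m ⋊ S_m` on `ℝ^m`. -/
def rep [NeZero m] : ArrangementRep K m where
  ρ := (signedPermRep m).comp Φ.rhoHom
  faithful g h hgh := by
    have key : ∀ i j, ((Φ.sgn g i : ℤ) : ℝ) * (Pi.single j 1 : Fin m → ℝ) (Φ.idx g i) =
        ((Φ.sgn h i : ℤ) : ℝ) * (Pi.single j 1 : Fin m → ℝ) (Φ.idx h i) := fun i j => by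
      rw [← rep_apply, ← rep_apply, hgh]
    have hi : Φ.idx g 0 = Φ.idx h 0 := by
      by_contra hne
      have := key 0 (Φ.idx g 0)
      rw [Pi.single_eq_same, Pi.single_eq_of_ne (Ne.symm hne), mul_one, mul_zero] at this
      exact Φ.sgn_ne_zero g 0 this
    have hs : Φ.sgn g 0 = Φ.sgn h 0 := by
      have := key 0 (Φ.idx g 0)
      rw [← hi, Pi.single_eq_same, mul_one, mul_one] at this
      exact Units.ext (by exact_mod_cast this)
    have := Φ.φ_mul g 0
    rw [hi, hs, ← φ_mul] at this
    exact mul_left_cancel this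
  permutes g i := ⟨Φ.idx g⁻¹ i, Φ.image_hyperplane g i _ (by
    rw [← idx_mul, inv_mul_cancel, idx_one])⟩
  transitive i j := ⟨(Φ.φ j)⁻¹ * Φ.φ i, Φ.image_hyperplane _ i j (by
    rw [idx, mul_inv_cancel_left, decomp_symm_φ])⟩
  conj_eq_neg := by
    refine LinearMap.ext fun x => funext fun i => ?_
    have h : Φ.decomp.symm (Φ.φ i * conj K) = (-1, i) := by
      rw [conj_comm, ← signConj_neg_one, decomp_symm_mul, decomp_symm_φ, mul_one]
    rw [rep_apply, sgn, idx, h]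
    simp

end NumberedCMType

/-- For `L` a lattice in the algebra `E = Hom(R(2^m), K)^G`, the lattice of the torus
`A(G, K, ρ) = A(R(2^m), R(2^m)⁺)` in `ℂ^{R(2^m)⁺}`. -/
def arrangementLattice [NeZero m] (r : ArrangementRep K m)
    (L : Submodule ℤ (equivariantMaps K r.Regions)) : Submodule ℤ (r.posRegions → ℂ) :=
  pairLattice r.posRegions L

end CMField

end CMArrangement

end

open CMArrangement

/-!
The regions of the arrangement of the coordinate hyperplanes are the open orthants, that is, the
sign vectors `ε ∈ {±}^m`. Through the decomposition `φ_i ∘ g = ι^{e(ε_i)} ∘ φ_j`, a region `R` is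
the same thing as the CM-type `{g ∈ G | g • R ∈ R(2^m)⁺}` on `K`, and every CM-type on `K` occurs
(`exists_region`). This makes the torus `A(G, K, ρ_Φ)` large enough to contain all simple CM abelian
varieties split by `K` up to isogeny.

*The torus `A(S, S⁺)` is an abelian variety* (`isAbelianVariety_pairLattice`). A `ℚ`-basis of
`E = Hom(S, K)^G` is independent over `K` by a trace argument, hence over `ℂ` in `ℂ^S`, hence over
`ℝ` in `ℂ^{S⁺}`, because the values of an equivariant map at `s` and `ι s` are conjugate. It spans
`ℂ^{S⁺}` over `ℝ` because the embeddings of `K` in `ℂ` are linearly independent. Therefore `E` is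
dense in `ℂ^{S⁺}`, so it contains an element `α` which is purely imaginary with negative imaginary
part at all `s ∈ S⁺`. A positive multiple of `(x, y) ↦ ∑_{s ∈ S⁺} 2 Re(α_s x̄_s y_s)` is then a
Riemann form, which is rational on `E` because it is a `G`-invariant sum over `S`.

*Simple CM abelian varieties* (`exists_isogenous_subvariety`). A homomorphism of complex tori which
is defined on a simple abelian variety `V / Λ` is zero or has finite kernel, since its kernel is
spanned by lattice vectors. So nonzero endomorphisms are injective, and `d ↦ d v₀` embeds
`End⁰(V / Λ)` in `Λ ⊗ ℚ`, for `v₀ ∈ Λ` nonzero. By counting dimensions, the given CM algebra `E` is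
all of `End⁰(V / Λ)`, and `E v₀ = Λ ⊗ ℚ`. As `V / Λ` is split by `K`, there is an embedding
`j : E → K`. For `ψ : E → ℂ`, let `λ_ψ : V → ℂ` be the `ℝ`-linear form with `λ_ψ(x v₀) = ψ(x)`.
Multiplication by `i` commutes with `E`, so `λ_ψ(i v) = ± i λ_ψ(v)`, and the sign changes when `ψ`
is replaced by its conjugate. Hence the `g ∈ G` for which `λ_{g ∘ j}` is `ℂ`-linear form a CM-type,
and this CM-type belongs to a region `R`. The map `V → ℂ^{S⁺}` whose component at `s` is the sum of
the `λ_{g ∘ j}` with `g • R = s` is `ℂ`-linear and nonzero, and takes `Λ ⊗ ℚ` into the algebra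
`Hom(S, K)^G`, so a multiple of it is a homomorphism of abelian varieties with finite kernel. Its
image is the required abelian subvariety.
-/

noncomputable section

namespace CMArrangement

/-! ### Lattices in real vector spaces -/

section Lattice

section

variable {k V : Type*} [Field k] [AddCommGroup V] [Module k V] {Λ : Submodule ℤ V}

theorem IsLattice.finiteDimensional (h : IsLattice k Λ) : FiniteDimensional k V := by
  obtain ⟨n, b, -⟩ := h
  exact b.finiteDimensional_of_finite

theorem IsLattice.finite (h : IsLattice k Λ) : Module.Finite ℤ Λ := by
  obtain ⟨n, b, rfl⟩ := h
  exact Module.Finite.span_of_finite ℤ (Set.finite_range _)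

end

variable {V : Type*} [AddCommGroup V] [Module ℝ V] {Λ : Submodule ℤ V}

theorem IsLattice.finite_of_le (h : IsLattice ℝ Λ) {M : Submodule ℤ V} (hM : M ≤ Λ) :
    Module.Finite ℤ M := by
  have := h.finite
  exact Module.Finite.of_injective (Submodule.inclusion hM) (Submodule.inclusion_injective hM)

theorem IsLattice.span_eq_top (h : IsLattice ℝ Λ) : Submodule.span ℝ (Λ : Set V) = ⊤ := by
  obtain ⟨n, b, rfl⟩ := h
  rw [Submodule.span_span_of_tower, b.span_eq]

/-- Integral linear independence in a lattice implies real linear independence: in a basis of the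
lattice, the coordinates of the vectors are integers. -/
theorem IsLattice.linearIndependent (h : IsLattice ℝ Λ) {κ : Type*} {v : κ → V}
    (hv : ∀ k, v k ∈ Λ) (hli : LinearIndependent ℤ v) : LinearIndependent ℝ v := by
  obtain ⟨n, b, rfl⟩ := h
  have h1 : LinearIndependent ℤ (fun k => (⟨v k, hv k⟩ : Submodule.span ℤ (Set.range b))) :=
    LinearIndependent.of_comp (Submodule.subtype _) hli
  have h2 : LinearIndependent ℤ (fun k => (b.restrictScalars ℤ).equivFun ⟨v k, hv k⟩) :=
    h1.map' (b.restrictScalars ℤ).equivFun.toLinearMap (LinearEquiv.ker _)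
  rw [← linearIndependent_algebraMap_comp_iff (S := ℝ)] at h2
  have h3 : (fun k => algebraMap ℤ ℝ ∘ (b.restrictScalars ℤ).equivFun ⟨v k, hv k⟩) =
      b.equivFun ∘ v := by
    funext k i
    exact b.restrictScalars_repr_apply ℤ _ i
  rw [h3] at h2
  exact LinearIndependent.of_comp b.equivFun.toLinearMap h2

theorem IsLattice.free_of_le (h : IsLattice ℝ Λ) {M : Submodule ℤ V} (hM : M ≤ Λ) :
    Module.Free ℤ M := by
  have := h.finite_of_le hM
  let := Module.compHom V (algebraMap ℚ ℝ)
  have : IsAddTorsionFree V := .of_module_rat V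
  infer_instance

theorem IsLattice.exists_basis_of_le (h : IsLattice ℝ Λ) {M : Submodule ℤ V} (hM : M ≤ Λ) :
    ∃ v : Fin (Module.finrank ℤ M) → V,
      LinearIndependent ℝ v ∧ M = Submodule.span ℤ (Set.range v) := by
  have := h.finite_of_le hM
  have := h.free_of_le hM
  let c := Module.finBasis ℤ M
  refine ⟨M.subtype ∘ c, h.linearIndependent (fun k => hM (c k).2)
    (c.linearIndependent.map' M.subtype (Submodule.ker_subtype _)), ?_⟩
  rw [Set.range_comp, Submodule.span_image, c.span_eq, Submodule.map_top, Submodule.range_subtype]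

/-- The rank of a subgroup of a lattice is the dimension of its real span. -/
theorem IsLattice.finrank_span (h : IsLattice ℝ Λ) {M : Submodule ℤ V} (hM : M ≤ Λ) :
    Module.finrank ℝ (Submodule.span ℝ (M : Set V)) = Module.finrank ℤ M := by
  obtain ⟨v, hli, hv⟩ := h.exists_basis_of_le hM
  have hs : Submodule.span ℝ (M : Set V) = Submodule.span ℝ (Set.range v) := by
    conv_lhs => rw [hv]
    rw [Submodule.span_span_of_tower]
  rw [hs, finrank_span_eq_card hli, Fintype.card_fin]

/-- A subgroup of a lattice which spans the space is a lattice. -/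
theorem IsLattice.of_le (h : IsLattice ℝ Λ) {M : Submodule ℤ V} (hM : M ≤ Λ)
    (hs : Submodule.span ℝ (M : Set V) = ⊤) : IsLattice ℝ M := by
  obtain ⟨v, hli, hv⟩ := h.exists_basis_of_le hM
  refine ⟨_, Module.Basis.mk hli ?_, ?_⟩
  · rw [← Submodule.span_span_of_tower ℤ, ← hv, hs]
  · rw [Module.Basis.coe_mk, ← hv]

/-- The kernel of a linear map between real vector spaces with lattices which respects the
lattices is spanned by its lattice points: the ranks of `Λ ∩ ker f` and `f Λ` are the dimensions of
their real spans, contained in `ker f` and equal to `range f`, and they add up to the rank of `Λ`. -/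
theorem IsLattice.span_inf_ker {V' : Type*} [AddCommGroup V'] [Module ℝ V'] {Λ' : Submodule ℤ V'}
    (h : IsLattice ℝ Λ) (h' : IsLattice ℝ Λ') (f : V →ₗ[ℝ] V') (hf : ∀ x ∈ Λ, f x ∈ Λ') :
    Submodule.span ℝ ((Λ ⊓ (LinearMap.ker f).restrictScalars ℤ : Submodule ℤ V) : Set V) =
      LinearMap.ker f := by
  have := h.finiteDimensional
  have := h.finite
  have := h.free_of_le le_rfl
  let fΛ : Λ →ₗ[ℤ] V' := (f.restrictScalars ℤ).domRestrict Λ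
  have hle : LinearMap.range fΛ ≤ Λ' := by
    rintro _ ⟨x, rfl⟩
    exact hf _ x.2
  have := h'.free_of_le hle
  have := h'.finite_of_le hle
  have hker : (LinearMap.ker fΛ).map Λ.subtype = Λ ⊓ (LinearMap.ker f).restrictScalars ℤ := by
    ext x
    simp [fΛ, and_comm]
  have h1 : Module.finrank ℤ (LinearMap.ker fΛ) =
      Module.finrank ℤ (Λ ⊓ (LinearMap.ker f).restrictScalars ℤ : Submodule ℤ V) := by
    rw [← hker]
    exact (Submodule.equivMapOfInjective Λ.subtype Λ.subtype_injective _).finrank_eq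
  have h2 := Submodule.finrank_quotient_add_finrank (LinearMap.ker fΛ)
  rw [fΛ.quotKerEquivRange.finrank_eq] at h2
  have h3 := LinearMap.finrank_range_add_finrank_ker f
  -- `h4`, `h5` and `h6` compare the ranks in `h2` with the dimensions in `h3`.
  have h4 := h.finrank_span (M := Λ ⊓ (LinearMap.ker f).restrictScalars ℤ) inf_le_left
  have h5 := h'.finrank_span hle
  have h6 := h.finrank_span le_rfl
  have h7 : Submodule.span ℝ (LinearMap.range fΛ : Set V') = LinearMap.range f := by
    have h8 : (LinearMap.range fΛ : Set V') = f '' Λ := by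
      ext y
      simp [fΛ]
    rw [h8, Submodule.span_image, h.span_eq_top, Submodule.map_top]
  rw [h7] at h5
  rw [h.span_eq_top, finrank_top] at h6
  refine Submodule.eq_of_le_of_finrank_eq (Submodule.span_le.2 fun x hx => hx.2) ?_
  omega

/-- A sublattice has finite index. -/
theorem IsLattice.finite_quotient (h : IsLattice ℝ Λ) {M : Submodule ℤ V} (hM : IsLattice ℝ M)
    (hle : M ≤ Λ) : Finite (Λ ⧸ M.submoduleOf Λ) := by
  have := h.finite
  have := h.free_of_le le_rfl
  apply Submodule.finiteQuotientOfFreeOfRankEq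
  rw [(Submodule.submoduleOfEquivOfLe hle).finrank_eq, ← h.finrank_span le_rfl,
    ← h.finrank_span hle, h.span_eq_top, hM.span_eq_top]

theorem IsLattice.map {V' : Type*} [AddCommGroup V'] [Module ℝ V'] (h : IsLattice ℝ Λ)
    (e : V ≃ₗ[ℝ] V') : IsLattice ℝ (Λ.map (e.toLinearMap.restrictScalars ℤ)) := by
  obtain ⟨n, b, rfl⟩ := h
  refine ⟨n, b.map e, ?_⟩
  rw [Submodule.map_span, ← Set.range_comp]
  rfl

end Lattice

/-! ### Homomorphisms of abelian varieties -/

section Homs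

variable {V : Type*} [AddCommGroup V] [Module ℂ V] {Λ : Submodule ℤ V}
variable {V' : Type*} [AddCommGroup V'] [Module ℂ V'] {Λ' : Submodule ℤ V'}

/-- A complex subspace spanned by lattice vectors gives an abelian subvariety. -/
theorem IsAbelianVariety.isAbelianSubvariety (h : IsAbelianVariety Λ) (W : Submodule ℂ V)
    (hW : W.restrictScalars ℝ ≤
      Submodule.span ℝ ((Λ ⊓ W.restrictScalars ℤ : Submodule ℤ V) : Set V)) :
    IsAbelianSubvariety Λ W := by
  constructor
  · obtain ⟨v, hli, hv⟩ := h.isLattice.exists_basis_of_le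
      (inf_le_left : Λ ⊓ W.restrictScalars ℤ ≤ Λ)
    have hvW : ∀ k, v k ∈ W := fun k =>
      ((hv ▸ Submodule.subset_span (Set.mem_range_self k) :
        v k ∈ Λ ⊓ W.restrictScalars ℤ)).2
    let w : Fin _ → W := fun k => ⟨v k, hvW k⟩
    let i : W →ₗ[ℝ] V := W.subtype.restrictScalars ℝ
    have hi : LinearMap.ker i = ⊥ := LinearMap.ker_eq_bot.2 W.subtype_injective
    have hw : i ∘ w = v := rfl
    have hwli : LinearIndependent ℝ w := LinearIndependent.of_comp i (hw ▸ hli)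
    refine ⟨_, Module.Basis.mk hwli ?_, ?_⟩
    · intro x _
      have hx := hW (x := i x) x.2
      rw [hv, Submodule.span_span_of_tower, ← hw, Set.range_comp, Submodule.span_image] at hx
      obtain ⟨y, hy, hyx⟩ := hx
      rwa [← LinearMap.ker_eq_bot.1 hi hyx]
    · rw [Module.Basis.coe_mk]
      apply Submodule.map_injective_of_injective
        (f := W.subtype.restrictScalars ℤ) W.subtype_injective
      rw [Submodule.map_span, ← Set.range_comp]
      change _ = Submodule.span ℤ (Set.range v)
      rw [← hv, subLattice, Submodule.map_comap_eq, inf_comm]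
      congr 1
      ext x
      simp
  · obtain ⟨E, hE⟩ := h.polarizable
    let i : W →ₗ[ℝ] V := W.subtype.restrictScalars ℝ
    refine ⟨E.compl₁₂ i i, ?_⟩
    constructor
    · exact fun x => hE.alternating x
    · exact fun x hx y hy => hE.integral x hx y hy
    · exact fun x y => hE.invariant x y
    · exact fun x hx => hE.pos x fun h0 => hx (Subtype.ext h0)

/-- A nonzero homomorphism from a simple abelian variety to a complex torus has finite kernel,
since its kernel is spanned by lattice vectors. -/
theorem IsAbelianVariety.injective_of_ne_zero (h : IsAbelianVariety Λ) (hs : IsSimple Λ)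
    (h' : IsLattice ℝ Λ') (f : V →ₗ[ℂ] V') (hf : ∀ x ∈ Λ, f x ∈ Λ') (hf0 : f ≠ 0) :
    Function.Injective f := by
  have key := h.isLattice.span_inf_ker h' (f.restrictScalars ℝ) hf
  rcases hs.2 (LinearMap.ker f) (h.isAbelianSubvariety _ key.ge) with h1 | h1
  · exact LinearMap.ker_eq_bot.1 h1
  · exact absurd (LinearMap.ker_eq_top.1 h1) hf0

/-- The image of an injective homomorphism of abelian varieties is an abelian subvariety, and is
isogenous to the source. -/
theorem IsAbelianVariety.isogenous_range (h : IsAbelianVariety Λ) (h' : IsAbelianVariety Λ')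
    (f : V →ₗ[ℂ] V') (hf : ∀ x ∈ Λ, f x ∈ Λ') (hinj : Function.Injective f) :
    IsAbelianSubvariety Λ' (LinearMap.range f) ∧
      Isogenous Λ (subLattice Λ' (LinearMap.range f)) := by
  have hsub : IsAbelianSubvariety Λ' (LinearMap.range f) := by
    apply h'.isAbelianSubvariety
    rintro _ ⟨x, rfl⟩
    have hx : x ∈ Submodule.span ℝ (Λ : Set V) := h.isLattice.span_eq_top ▸ Submodule.mem_top
    have := Submodule.mem_map_of_mem (f := f.restrictScalars ℝ) hx
    rw [← Submodule.span_image] at this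
    refine Submodule.span_mono ?_ this
    rintro _ ⟨y, hy, rfl⟩
    exact ⟨hf y hy, y, rfl⟩
  refine ⟨hsub, ?_⟩
  let e : V ≃ₗ[ℂ] LinearMap.range f := LinearEquiv.ofInjective f hinj
  have he : Λ ≤ (subLattice Λ' (LinearMap.range f)).comap (e.toLinearMap.restrictScalars ℤ) :=
    fun x hx => hf x hx
  refine ⟨e, he, ?_, ?_⟩
  · intro y
    obtain ⟨y, rfl⟩ := Submodule.Quotient.mk_surjective _ y
    obtain ⟨x, rfl⟩ := e.surjective y
    exact ⟨Submodule.Quotient.mk x, rfl⟩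
  · rw [Submodule.ker_mapQ]
    set M := (subLattice Λ' (LinearMap.range f)).comap (e.toLinearMap.restrictScalars ℤ) with hM
    have hMlat : IsLattice ℝ M := by
      have := hsub.isLattice.map (e.symm.restrictScalars ℝ)
      convert this
      ext x
      constructor
      · intro hx
        exact ⟨e x, hx, e.symm_apply_apply x⟩
      · rintro ⟨y, hy, rfl⟩
        change e (e.symm y) ∈ subLattice Λ' (LinearMap.range f)
        rwa [e.apply_symm_apply]
    have := hMlat.finite_quotient h.isLattice he
    have hr : M.map Λ.mkQ = LinearMap.range (Λ.mkQ.domRestrict M) := by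
      ext x
      simp
    rw [hr]
    have hk : LinearMap.ker (Λ.mkQ.domRestrict M) = Λ.submoduleOf M := by
      ext x
      simp [Submodule.submoduleOf]
    rw [← hk] at this
    exact Finite.of_equiv _ (LinearMap.quotKerEquivRange (Λ.mkQ.domRestrict M)).toEquiv

end Homs

/-! ### Equivariant maps -/

section Equivariant

variable {K : IntermediateField ℚ ℂ} {S : Type*} [MulAction Gal(K/ℚ) S]

theorem equivariantMaps_smul (F : equivariantMaps K S) (g : Gal(K/ℚ)) (s : S) :
    F.1 (g • s) = g (F.1 s) := F.2 g s

theorem evalPos_apply (Splus : Set S) (F : equivariantMaps K S) (s : Splus) :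
    evalPos Splus F s = (F.1 s : ℂ) := rfl

variable [FiniteDimensional ℚ K]

/-- Equivariant maps which are linearly independent over `ℚ` are linearly independent over `K`:
taking traces turns a relation over `K` into relations over `ℚ`. -/
theorem linearIndependent_equivariantMaps [IsGalois ℚ K] {κ : Type*} [Finite κ]
    {F : κ → equivariantMaps K S} (hF : LinearIndependent ℚ F) :
    LinearIndependent K (fun k => (F k).1) := by
  have := Fintype.ofFinite κ
  rw [Fintype.linearIndependent_iff] at hF ⊢
  intro a ha
  have key : ∀ (x : K) (k : κ), Algebra.trace ℚ K (a k * x) = 0 := by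
    intro x
    apply hF
    refine Subtype.ext (funext fun s => ?_)
    have h1 : ∀ g : Gal(K/ℚ), ∑ k, g (a k) * (F k).1 s = 0 := by
      intro g
      have h2 := congrArg g (congrFun ha (g⁻¹ • s))
      simp only [Finset.sum_apply, Pi.smul_apply, smul_eq_mul, map_sum, map_mul, Pi.zero_apply,
        map_zero, ← equivariantMaps_smul, smul_inv_smul] at h2
      exact h2
    have h3 : (∑ k, Algebra.trace ℚ K (a k * x) • F k).1 s =
        ∑ k, Algebra.trace ℚ K (a k * x) • (F k).1 s := by
      simp [Finset.sum_apply]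
    rw [h3]
    simp only [Algebra.smul_def, trace_eq_sum_automorphisms, Finset.sum_mul]
    rw [Finset.sum_comm]
    refine Finset.sum_eq_zero fun g _ => ?_
    calc ∑ k, g (a k * x) * (F k).1 s = g x * ∑ k, g (a k) * (F k).1 s := by
          rw [Finset.mul_sum]
          exact Finset.sum_congr rfl fun k _ => by rw [map_mul]; ring
      _ = 0 := by rw [h1, mul_zero]
  intro k
  exact (traceForm_nondegenerate ℚ K).1 (a k) fun x => key x k

open Classical in
/-- The equivariant map `s ↦ ∑ g x`, where the sum is over the elements `g` of `G` with
`g • t = s`. -/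
def orbitSum (t : S) (x : K) : equivariantMaps K S :=
  ⟨fun s => ∑ g : Gal(K/ℚ), if g • t = s then g x else 0, by
    intro h s
    change (∑ g : Gal(K/ℚ), if g • t = h • s then g x else 0) =
      h (∑ g : Gal(K/ℚ), if g • t = s then g x else 0)
    rw [map_sum, ← Equiv.sum_comp (Equiv.mulLeft h) fun g => if g • t = h • s then g x else 0]
    refine Finset.sum_congr rfl fun g _ => ?_
    simp only [Equiv.coe_mulLeft, mul_smul, smul_left_cancel_iff]
    split_ifs <;> simp⟩

open Classical in
theorem orbitSum_apply (t : S) (x : K) (s : S) :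
    (orbitSum t x).1 s = ∑ g : Gal(K/ℚ), if g • t = s then g x else 0 := rfl

theorem sum_mul_orbitSum [Fintype S] (d : S → ℂ) (t : S) (x : K) :
    ∑ s, d s * ((orbitSum t x).1 s : ℂ) = ∑ g : Gal(K/ℚ), d (g • t) * (g x : ℂ) := by
  classical
  simp only [orbitSum_apply, AddSubmonoidClass.coe_finsetSum, Finset.mul_sum]
  rw [Finset.sum_comm]
  refine Finset.sum_congr rfl fun g _ => ?_
  rw [Finset.sum_eq_single (g • t)]
  · simp
  · intro s _ hs
    simp [hs.symm]
  · simp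

/-- A linear form on `ℂ^S` which vanishes on all equivariant maps is zero, because the embeddings
of `K` in `ℂ` are linearly independent. -/
theorem eq_zero_of_sum_mul_eq_zero [Fintype S] (d : S → ℂ)
    (hd : ∀ F : equivariantMaps K S, ∑ s, d s * (F.1 s : ℂ) = 0) : d = 0 := by
  funext t
  let χ : Gal(K/ℚ) → (K →* ℂ) := fun g => (K.val.comp g.toAlgHom : K →ₐ[ℚ] ℂ)
  have hχ : Function.Injective χ := by
    intro g h hgh
    ext x
    exact DFunLike.congr_fun hgh x
  have hli := (linearIndependent_monoidHom K ℂ).comp χ hχ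
  have h := Fintype.linearIndependent_iff.1 hli (fun g => d (g • t)) (by
    funext x
    have := hd (orbitSum t x)
    rw [sum_mul_orbitSum] at this
    simp only [Finset.sum_apply, Pi.smul_apply, smul_eq_mul, Function.comp_apply, Pi.zero_apply]
    exact this) 1
  simpa using h

end Equivariant

/-! ### The complex torus `A(S, S⁺)` is an abelian variety -/

section PairsAV

variable {K : IntermediateField ℚ ℂ} [FiniteDimensional ℚ K] [NumberField.IsCMField K]
variable {S : Type*} [MulAction Gal(K/ℚ) S] {Splus : Set S}

theorem coe_apply_conj_smul (F : equivariantMaps K S) (s : S) :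
    (F.1 (conj K • s) : ℂ) = (starRingEnd ℂ) (F.1 s) := by
  rw [equivariantMaps_smul, coe_conj]

theorem conj_smul_conj_smul (s : S) : conj K • conj K • s = s := by
  rw [smul_smul, conj_mul_conj, one_smul]

/-- If `S` is the disjoint union of `S⁺` and `ι S⁺`, a sum over `S` is a sum over `S⁺`. -/
theorem sum_eq_sum_pos [Fintype S] [Fintype Splus]
    (hS : ∀ s, conj K • s ∈ Splus ↔ s ∉ Splus) {M : Type*} [AddCommMonoid M] (h : S → M) :
    ∑ s, h s = ∑ s : Splus, (h s + h (conj K • (s : S))) := by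
  classical
  let e : Splus ⊕ Splus → S := Sum.elim (fun s => s) (fun s => conj K • (s : S))
  have he : Function.Bijective e := by
    constructor
    · rintro (⟨s, hs⟩ | ⟨s, hs⟩) (⟨t, ht⟩ | ⟨t, ht⟩) hst <;> simp only [e, Sum.elim_inl,
        Sum.elim_inr] at hst
      · subst hst; rfl
      · subst hst; exact absurd ht ((hS t).1 hs)
      · subst hst; exact absurd hs ((hS s).1 ht)
      · rw [smul_left_cancel_iff] at hst; subst hst; rfl
    · intro s
      by_cases hs : s ∈ Splus
      · exact ⟨Sum.inl ⟨s, hs⟩, rfl⟩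
      · exact ⟨Sum.inr ⟨conj K • s, (hS s).2 hs⟩, conj_smul_conj_smul s⟩
  rw [← (Equiv.ofBijective e he).sum_comp h, Fintype.sum_sum_type, Finset.sum_add_distrib]
  rfl

theorem linearIndependent_evalPos [IsGalois ℚ K] [Finite S]
    (hS : ∀ s, conj K • s ∈ Splus ↔ s ∉ Splus) {κ : Type*} [Finite κ]
    {F : κ → equivariantMaps K S} (hF : LinearIndependent ℚ F) :
    LinearIndependent ℝ (fun k => evalPos Splus (F k)) := by
  have := Fintype.ofFinite κ
  have h1 := linearIndependent_equivariantMaps hF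
  rw [← linearIndependent_algebraMap_comp_iff (S := ℂ), Fintype.linearIndependent_iff] at h1
  rw [Fintype.linearIndependent_iff]
  intro r hr k
  have h2 : ∀ s ∈ Splus, ∑ k, (r k : ℂ) * ((F k).1 s : ℂ) = 0 := by
    intro s hs
    have := congrFun hr ⟨s, hs⟩
    simpa [evalPos_apply] using this
  have h3 : ∀ s, ∑ k, (r k : ℂ) * ((F k).1 s : ℂ) = 0 := by
    intro s
    by_cases hs : s ∈ Splus
    · exact h2 s hs
    · have := h2 _ ((hS s).2 hs)
      apply (starRingEnd ℂ).injective
      simpa [coe_apply_conj_smul] using this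
  have := h1 (fun k => (r k : ℂ)) (by
    funext s
    simpa using h3 s) k
  exact_mod_cast this

/-- `E` spans `ℂ^{S⁺}` over `ℝ`: a real linear form vanishing on `E` extends to a complex linear
form on `ℂ^S` vanishing on `E`. -/
theorem span_evalPos [Finite S] (hS : ∀ s, conj K • s ∈ Splus ↔ s ∉ Splus) :
    Submodule.span ℝ (Set.range (evalPos (K := K) Splus)) = ⊤ := by
  classical
  have := Fintype.ofFinite S
  have := Fintype.ofFinite Splus
  by_contra hne
  obtain ⟨l, hl0, hl⟩ := Submodule.exists_le_ker_of_lt_top _ (lt_top_iff_ne_top.2 hne)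
  -- The coefficients for which `l z` is the real part of `∑ s, c s * z s`.
  let c : Splus → ℂ := fun s =>
    ⟨l (Pi.single s 1), -l (Pi.single s Complex.I)⟩
  have hc : ∀ z : Splus → ℂ, l z = ∑ s, (c s * z s).re := by
    intro z
    have hz : ∀ s, (Pi.single s (z s) : Splus → ℂ) =
        (z s).re • (Pi.single s 1 : Splus → ℂ) + (z s).im • (Pi.single s Complex.I : Splus → ℂ) := by
      intro s
      rw [← Pi.single_smul', ← Pi.single_smul', ← Pi.single_add]
      congr 1
      simp
    conv_lhs => rw [← Finset.univ_sum_single z, map_sum]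
    refine Finset.sum_congr rfl fun s _ => ?_
    rw [hz s, map_add, map_smul, map_smul, Complex.mul_re]
    simp only [smul_eq_mul, c]
    ring
  -- The extension of `c` to `S` for which `∑ s, d s * F s = 2 l(F)` for `F` in `E`.
  let d : S → ℂ := fun s =>
    if h : s ∈ Splus then c ⟨s, h⟩ else (starRingEnd ℂ) (c ⟨conj K • s, (hS s).2 h⟩)
  have hd1 : ∀ s : Splus, d s = c s := fun s => by simp [d]
  have hd2 : ∀ s : Splus, d (conj K • (s : S)) = (starRingEnd ℂ) (c s) := fun s => by
    have : conj K • (s : S) ∉ Splus := fun h => (hS _).1 h s.2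
    simp [d, this, conj_smul_conj_smul]
  have hd : d = 0 := by
    refine eq_zero_of_sum_mul_eq_zero (K := K) d fun F => ?_
    have h1 : l (evalPos Splus F) = 0 := hl (Submodule.subset_span ⟨F, rfl⟩)
    rw [hc] at h1
    rw [sum_eq_sum_pos hS]
    have h2 : ∀ s : Splus, d s * (F.1 s : ℂ) + d (conj K • (s : S)) * (F.1 (conj K • (s : S)) : ℂ)
        = ((2 * (c s * evalPos Splus F s).re : ℝ) : ℂ) := by
      intro s
      rw [hd1, hd2, coe_apply_conj_smul, ← map_mul, Complex.add_conj]
      rfl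
    simp only [h2]
    rw [← Complex.ofReal_sum, ← Finset.mul_sum, h1]
    simp
  apply hl0
  ext z
  have hcs : ∀ s, c s = 0 := fun s => by rw [← hd1, hd]; rfl
  simp [hc, hcs]

/-- The images in `ℂ^{S⁺}` of the elements of a `ℚ`-basis of `E` are a real basis. -/
theorem exists_basis_evalPos [IsGalois ℚ K] [Finite S]
    (hS : ∀ s, conj K • s ∈ Splus ↔ s ∉ Splus) {κ : Type*} [Finite κ]
    (b : Module.Basis κ ℚ (equivariantMaps K S)) :
    ∃ w : Module.Basis κ ℝ (Splus → ℂ), ∀ k, w k = evalPos Splus (b k) := by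
  have := Fintype.ofFinite κ
  refine ⟨Module.Basis.mk (linearIndependent_evalPos hS b.linearIndependent) ?_,
    fun k => Module.Basis.mk_apply _ _ k⟩
  rw [← span_evalPos hS, Submodule.span_le]
  rintro _ ⟨F, rfl⟩
  have h : evalPos Splus F = ∑ k, (b.repr F k : ℝ) • evalPos Splus (b k) := by
    funext s
    conv_lhs => rw [← b.sum_repr F]
    simp [evalPos_apply, Finset.sum_apply, Algebra.smul_def]
  rw [h]
  exact Submodule.sum_mem _ fun k _ => Submodule.smul_mem _ _ (Submodule.subset_span ⟨k, rfl⟩)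

theorem isLattice_pairLattice [IsGalois ℚ K] [Finite S]
    (hS : ∀ s, conj K • s ∈ Splus ↔ s ∉ Splus) {L : Submodule ℤ (equivariantMaps K S)}
    (hL : IsLattice ℚ L) : IsLattice ℝ (pairLattice Splus L) := by
  obtain ⟨n, b, rfl⟩ := hL
  obtain ⟨w, hw⟩ := exists_basis_evalPos hS b
  refine ⟨n, w, ?_⟩
  rw [pairLattice, Submodule.map_span, ← Set.range_comp]
  congr 2
  funext k
  exact (hw k).symm

/-- A totally imaginary element of `E` whose imaginary part is negative at the elements of `S⁺`.
It exists because `E` is dense in `ℂ^{S⁺}`. -/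
theorem exists_imaginary [IsGalois ℚ K] [Finite S]
    (hS : ∀ s, conj K • s ∈ Splus ↔ s ∉ Splus) :
    ∃ α : equivariantMaps K S, (∀ s, (starRingEnd ℂ) (α.1 s : ℂ) = -(α.1 s : ℂ)) ∧
      ∀ s ∈ Splus, (α.1 s : ℂ).im < 0 := by
  have := Fintype.ofFinite S
  obtain ⟨x, hx⟩ : ∃ x : equivariantMaps K S, ∀ s ∈ Splus, (x.1 s : ℂ).im < 0 := by
    let b := Module.finBasis ℚ (equivariantMaps K S)
    obtain ⟨w, hw⟩ := exists_basis_evalPos hS b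
    let U : Set (Fin _ → ℝ) := {q | ∀ s : Splus, ((∑ k, q k • w k) s).im < 0}
    have hU : IsOpen U := by
      have : Finite Splus := inferInstance
      rw [show U = ⋂ s : Splus, {q | ((∑ k, q k • w k) s).im < 0} by ext; simp [U]]
      refine isOpen_iInter_of_finite fun s => isOpen_lt ?_ continuous_const
      simp only [Finset.sum_apply, Pi.smul_apply]
      fun_prop
    have hne : U.Nonempty := by
      refine ⟨w.repr fun _ => -Complex.I, fun s => ?_⟩
      rw [w.sum_repr]
      simp
    have hdense : DenseRange (fun (q : Fin (Module.finrank ℚ (equivariantMaps K S)) → ℚ) k =>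
        (q k : ℝ)) := DenseRange.piMap fun _ => Rat.denseRange_cast
    obtain ⟨q, hq⟩ := hdense.exists_mem_open hU hne
    refine ⟨∑ k, q k • b k, fun s hs => ?_⟩
    have := hq ⟨s, hs⟩
    simpa [hw, evalPos_apply, Finset.sum_apply, Algebra.smul_def] using this
  -- Subtracting the conjugate `s ↦ x (ι s)` leaves twice the imaginary part; it is equivariant
  -- because `ι` is central.
  let y : equivariantMaps K S := ⟨fun s => x.1 (conj K • s), fun g s => by
    change x.1 (conj K • g • s) = g (x.1 (conj K • s))
    rw [smul_smul, ← conj_comm, mul_smul, equivariantMaps_smul]⟩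
  have hy : ∀ s, ((x - y).1 s : ℂ) = x.1 s - (starRingEnd ℂ) (x.1 s : ℂ) := fun s => by
    rw [← coe_apply_conj_smul]
    rfl
  refine ⟨x - y, fun s => ?_, fun s hs => ?_⟩
  · rw [hy]
    simp
  · rw [hy]
    have := hx s hs
    simp
    linarith

end PairsAV

/-- A bilinear form which is rational on finitely many vectors becomes integral on the group
generated by them after multiplication by a positive integer. -/
theorem exists_pos_mul_integral {V : Type*} [AddCommGroup V] [Module ℝ V]
    (B : V →ₗ[ℝ] V →ₗ[ℝ] ℝ) {κ : Type*} [Finite κ] (w : κ → V)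
    (hw : ∀ k l, ∃ q : ℚ, B (w k) (w l) = q) :
    ∃ N : ℕ, 0 < N ∧ ∀ x ∈ Submodule.span ℤ (Set.range w), ∀ y ∈ Submodule.span ℤ (Set.range w),
      ∃ n : ℤ, N * B x y = n := by
  have := Fintype.ofFinite κ
  choose q hq using hw
  refine ⟨∏ p : κ × κ, (q p.1 p.2).den, Finset.prod_pos fun p _ => (q p.1 p.2).den_pos, ?_⟩
  intro x hx y hy
  induction hx, hy using Submodule.span_induction₂ with
  | mem_mem x y hx hy =>
    obtain ⟨k, rfl⟩ := hx
    obtain ⟨l, rfl⟩ := hy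
    obtain ⟨c, hc⟩ := Finset.dvd_prod_of_mem (fun p : κ × κ => (q p.1 p.2).den)
      (Finset.mem_univ (k, l))
    refine ⟨c * (q k l).num, ?_⟩
    have h1 : ((q k l).den : ℝ) * (q k l : ℝ) = (q k l).num := by
      exact_mod_cast Rat.den_mul_eq_num (q k l)
    rw [hc, hq]
    push_cast
    rw [← h1]
    ring
  | zero_left y _ => exact ⟨0, by simp⟩
  | zero_right x _ => exact ⟨0, by simp⟩
  | add_left x y z _ _ _ hx hy =>
    obtain ⟨a, ha⟩ := hx
    obtain ⟨b, hb⟩ := hy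
    exact ⟨a + b, by rw [map_add, LinearMap.add_apply, mul_add, ha, hb]; push_cast; rfl⟩
  | add_right x y z _ _ _ hx hy =>
    obtain ⟨a, ha⟩ := hx
    obtain ⟨b, hb⟩ := hy
    exact ⟨a + b, by rw [map_add, mul_add, ha, hb]; push_cast; rfl⟩
  | smul_left r x y _ _ hx =>
    obtain ⟨a, ha⟩ := hx
    refine ⟨r * a, ?_⟩
    rw [map_zsmul, LinearMap.smul_apply, zsmul_eq_mul, mul_left_comm, ha]
    push_cast
    rfl
  | smul_right r x y _ _ hx =>
    obtain ⟨a, ha⟩ := hx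
    refine ⟨r * a, ?_⟩
    rw [map_zsmul, zsmul_eq_mul, mul_left_comm, ha]
    push_cast
    rfl

section

variable {K : IntermediateField ℚ ℂ} [FiniteDimensional ℚ K] [NumberField.IsCMField K]
variable {S : Type*} [MulAction Gal(K/ℚ) S] {Splus : Set S}

/-- The real bilinear form `(x, y) ↦ ∑ 2 Re(α_s x̄_s y_s)` on `ℂ^T`. -/
def weightedForm {T : Type*} [Fintype T] (α : T → ℂ) :
    (T → ℂ) →ₗ[ℝ] (T → ℂ) →ₗ[ℝ] ℝ :=
  LinearMap.mk₂ ℝ (fun x y => ∑ s, 2 * (α s * (starRingEnd ℂ) (x s) * y s).re)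
    (fun x x' y => by
      rw [← Finset.sum_add_distrib]
      refine Finset.sum_congr rfl fun s _ => ?_
      rw [Pi.add_apply, map_add, mul_add, add_mul, Complex.add_re, mul_add])
    (fun c x y => by
      rw [Finset.smul_sum]
      refine Finset.sum_congr rfl fun s _ => ?_
      rw [Pi.smul_apply, Complex.real_smul, map_mul, Complex.conj_ofReal, smul_eq_mul,
        show α s * (c * (starRingEnd ℂ) (x s)) * y s = c * (α s * (starRingEnd ℂ) (x s) * y s) by
          ring, Complex.re_ofReal_mul]
      ring)
    (fun x y y' => by
      rw [← Finset.sum_add_distrib]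
      refine Finset.sum_congr rfl fun s _ => ?_
      rw [Pi.add_apply, mul_add, Complex.add_re, mul_add])
    (fun c x y => by
      rw [Finset.smul_sum]
      refine Finset.sum_congr rfl fun s _ => ?_
      rw [Pi.smul_apply, Complex.real_smul, smul_eq_mul,
        show α s * (starRingEnd ℂ) (x s) * (c * y s) = c * (α s * (starRingEnd ℂ) (x s) * y s) by
          ring, Complex.re_ofReal_mul]
      ring)

theorem weightedForm_apply {T : Type*} [Fintype T] (α x y : T → ℂ) :
    weightedForm α x y = ∑ s, 2 * (α s * (starRingEnd ℂ) (x s) * y s).re := rfl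

/-- On `E`, the form attached to `α ∈ E` is `(F, F') ↦ ∑_{s ∈ S} α(s) F(ι s) F'(s)`, which is
`G`-invariant, hence rational. -/
theorem weightedForm_rational [IsGalois ℚ K] [Finite S] [Fintype Splus]
    (hS : ∀ s, conj K • s ∈ Splus ↔ s ∉ Splus) (α F F' : equivariantMaps K S) :
    ∃ q : ℚ, weightedForm (evalPos Splus α) (evalPos Splus F) (evalPos Splus F') = q := by
  have := Fintype.ofFinite S
  -- As `F (ι s)` is conjugate to `F s`, this is the value of the form.
  let z : K := ∑ s, α.1 s * F.1 (conj K • s) * F'.1 s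
  have hz : z ∈ (⊥ : IntermediateField ℚ K) := by
    rw [IsGalois.mem_bot_iff_fixed]
    intro g
    simp only [z, map_sum, map_mul, ← equivariantMaps_smul]
    refine Eq.trans ?_ (Equiv.sum_comp (MulAction.toPerm g)
      fun s => α.1 s * F.1 (conj K • s) * F'.1 s)
    refine Finset.sum_congr rfl fun s _ => ?_
    simp only [MulAction.toPerm_apply, smul_smul, conj_comm]
  obtain ⟨q, hq⟩ := IntermediateField.mem_bot.1 hz
  refine ⟨q, ?_⟩
  have h1 : ((weightedForm (evalPos Splus α) (evalPos Splus F) (evalPos Splus F') : ℝ) : ℂ) =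
      (z : ℂ) := by
    rw [weightedForm_apply]
    simp only [z, AddSubmonoidClass.coe_finsetSum, MulMemClass.coe_mul]
    rw [sum_eq_sum_pos hS, Complex.ofReal_sum]
    refine Finset.sum_congr rfl fun s _ => ?_
    rw [conj_smul_conj_smul, coe_apply_conj_smul, coe_apply_conj_smul, coe_apply_conj_smul,
      ← Complex.add_conj]
    simp [evalPos_apply]
  rw [← hq, eq_ratCast] at h1
  exact Complex.ofReal_injective (h1.trans (by simp))

/-- For any lattice in `E`, the torus `A(S, S⁺)` is an abelian variety. -/
theorem isAbelianVariety_pairLattice [IsGalois ℚ K] [Finite S]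
    (hS : ∀ s, conj K • s ∈ Splus ↔ s ∉ Splus) {L : Submodule ℤ (equivariantMaps K S)}
    (hL : IsLattice ℚ L) : IsAbelianVariety (pairLattice Splus L) := by
  refine ⟨isLattice_pairLattice hS hL, ?_⟩
  have := Fintype.ofFinite Splus
  obtain ⟨α, hα, hneg⟩ := exists_imaginary (K := K) hS
  obtain ⟨n, b, rfl⟩ := hL
  obtain ⟨N, hN, hint⟩ := exists_pos_mul_integral (weightedForm (evalPos Splus α))
    (fun k => evalPos Splus (b k)) (fun k l => weightedForm_rational hS α (b k) (b l))
  have hspan : pairLattice Splus (Submodule.span ℤ (Set.range b)) =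
      Submodule.span ℤ (Set.range fun k => evalPos Splus (b k)) := by
    rw [pairLattice, Submodule.map_span, ← Set.range_comp]
    rfl
  have hN' : (0 : ℝ) < N := by exact_mod_cast hN
  have hre : ∀ s : Splus, (evalPos Splus α s).re = 0 := fun s => by
    have := congrArg Complex.re (hα s)
    rw [Complex.conj_re, Complex.neg_re] at this
    rw [evalPos_apply]
    linarith
  refine ⟨(N : ℝ) • weightedForm (evalPos Splus α), ?_, ?_, ?_, ?_⟩
  · intro x
    change (N : ℝ) * weightedForm (evalPos Splus α) x x = 0
    rw [weightedForm_apply, Finset.sum_eq_zero, mul_zero]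
    intro s _
    simp [hre]
    ring
  · rw [hspan]
    exact hint
  · intro x y
    change (N : ℝ) * weightedForm (evalPos Splus α) (Complex.I • x) (Complex.I • y) =
      (N : ℝ) * weightedForm (evalPos Splus α) x y
    rw [weightedForm_apply, weightedForm_apply]
    congr 1
    refine Finset.sum_congr rfl fun s _ => ?_
    simp
    ring
  · intro x hx
    change 0 < (N : ℝ) * weightedForm (evalPos Splus α) x (Complex.I • x)
    refine mul_pos hN' ?_
    rw [weightedForm_apply]
    have hterm : ∀ s, 2 * (evalPos Splus α s * (starRingEnd ℂ) (x s) * (Complex.I • x) s).re =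
        2 * (-(evalPos Splus α s).im) * ((x s).re ^ 2 + (x s).im ^ 2) := by
      intro s
      simp [hre]
      ring
    simp only [hterm]
    have him : ∀ s : Splus, 0 < -(evalPos Splus α s).im := fun s => by
      have := hneg s s.2
      rw [evalPos_apply]
      linarith
    obtain ⟨s, hs⟩ := Function.ne_iff.1 hx
    refine Finset.sum_pos' (fun t _ => ?_) ⟨s, Finset.mem_univ _, ?_⟩
    · have := him t
      positivity
    · have h1 := him s
      have h2 : 0 < (x s).re ^ 2 + (x s).im ^ 2 := by
        have := Complex.normSq_pos.2 hs
        rw [Complex.normSq_apply] at this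
        nlinarith
      positivity

end

/-! ### The regions of the arrangement -/

theorem mem_arrangementCompl {m : ℕ} {x : Fin m → ℝ} :
    x ∈ arrangementCompl m ↔ ∀ i, x i ≠ 0 := by
  simp [arrangementCompl, coordHyperplane]

/-- The region of `x` is the open orthant containing `x`. -/
theorem connectedComponentIn_arrangementCompl {m : ℕ} {x : Fin m → ℝ}
    (hx : x ∈ arrangementCompl m) :
    connectedComponentIn (arrangementCompl m) x = {y | ∀ i, 0 < x i * y i} := by
  rw [mem_arrangementCompl] at hx
  apply Set.Subset.antisymm
  · intro y hy i
    by_contra hle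
    have hpre : IsPreconnected ((fun z : Fin m → ℝ => z i) ''
        connectedComponentIn (arrangementCompl m) x) :=
      isPreconnected_connectedComponentIn.image _ (continuous_apply i).continuousOn
    have hxm := mem_connectedComponentIn (mem_arrangementCompl.2 hx)
    have h0 : (0 : ℝ) ∈ Set.uIcc (x i) (y i) := by
      rw [Set.mem_uIcc]
      rcases lt_or_gt_of_ne (hx i) with h | h
      · exact Or.inl ⟨h.le, by nlinarith⟩
      · exact Or.inr ⟨by nlinarith, h.le⟩
    obtain ⟨z, hz, hz0⟩ := hpre.ordConnected.uIcc_subset ⟨x, hxm, rfl⟩ ⟨y, hy, rfl⟩ h0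
    exact mem_arrangementCompl.1 (connectedComponentIn_subset _ _ hz) i hz0
  · apply IsPreconnected.subset_connectedComponentIn
    · apply Convex.isPreconnected
      intro y hy z hz a b ha hb hab i
      have h1 := hy i
      have h2 := hz i
      change 0 < x i * (a * y i + b * z i)
      rcases ha.lt_or_eq with ha | rfl
      · nlinarith [mul_pos ha h1, mul_nonneg hb h2.le]
      · obtain rfl : b = 1 := by linarith
        simpa using h2
    · exact fun i => mul_self_pos.2 (hx i)
    · intro y hy
      rw [mem_arrangementCompl]
      intro i h
      have := hy i
      simp [h] at this

section Regions

variable {K : IntermediateField ℚ ℂ} [FiniteDimensional ℚ K] [NumberField.IsCMField K] {m : ℕ}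

theorem signVector_mem_arrangementCompl (ε : Fin m → ℤˣ) :
    (fun i => ((ε i : ℤ) : ℝ)) ∈ arrangementCompl m := by
  rw [mem_arrangementCompl]
  intro i
  exact_mod_cast (ε i).ne_zero

/-- The region containing the sign vector `ε`. -/
def signRegion (r : ArrangementRep K m) (ε : Fin m → ℤˣ) : r.Regions :=
  ⟨connectedComponentIn (arrangementCompl m) fun i => ((ε i : ℤ) : ℝ), _,
    signVector_mem_arrangementCompl ε, rfl⟩

theorem mem_signRegion (r : ArrangementRep K m) (ε : Fin m → ℤˣ) (y : Fin m → ℝ) :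
    y ∈ (signRegion r ε).1 ↔ ∀ i, 0 < ((ε i : ℤ) : ℝ) * y i := by
  change y ∈ connectedComponentIn (arrangementCompl m) _ ↔ _
  rw [connectedComponentIn_arrangementCompl (signVector_mem_arrangementCompl ε)]
  rfl

theorem signRegion_surjective (r : ArrangementRep K m) : Function.Surjective (signRegion r) := by
  rintro ⟨R, x, hx, rfl⟩
  refine ⟨fun i => if 0 < x i then 1 else -1, Subtype.ext (Set.ext fun y => ?_)⟩
  rw [mem_signRegion]
  change _ ↔ y ∈ connectedComponentIn (arrangementCompl m) x
  rw [connectedComponentIn_arrangementCompl hx]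
  refine forall_congr' fun i => ?_
  have hxi := mem_arrangementCompl.1 hx i
  split_ifs with h
  · simp [mul_pos_iff_of_pos_left h]
  · have h' : x i < 0 := lt_of_le_of_ne (not_lt.1 h) hxi
    simp [mul_pos_iff, h, h']

instance (r : ArrangementRep K m) : Finite r.Regions :=
  Finite.of_surjective _ (signRegion_surjective r)

theorem signRegion_mem_posRegions [NeZero m] (r : ArrangementRep K m) (ε : Fin m → ℤˣ) :
    signRegion r ε ∈ r.posRegions ↔ ε 0 = 1 := by
  constructor
  · intro h
    have h1 := h (fun i => ((ε i : ℤ) : ℝ)) ((mem_signRegion r ε _).2 fun i =>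
      mul_self_pos.2 (mem_arrangementCompl.1 (signVector_mem_arrangementCompl ε) i))
    rcases Int.units_eq_one_or (ε 0) with h2 | h2
    · exact h2
    · rw [h2] at h1
      norm_num at h1
  · intro h x hx
    have := (mem_signRegion r ε x).1 hx 0
    simpa [h] using this

variable [NeZero m] (Φ : NumberedCMType K m)

theorem smul_signRegion (g : Gal(K/ℚ)) (ε : Fin m → ℤˣ) :
    g • signRegion Φ.rep ε = signRegion Φ.rep fun i => Φ.sgn g i * ε (Φ.idx g i) := by
  apply Subtype.ext
  have h := (Φ.rep.homeo g).image_connectedComponentIn (signVector_mem_arrangementCompl ε)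
  rw [Φ.rep.image_compl g] at h
  refine h.trans ?_
  rw [signRegion]
  congr 1
  funext i
  refine Eq.trans (b := ((Φ.sgn g i : ℤ) : ℝ) * ((ε (Φ.idx g i) : ℤ) : ℝ)) ?_ ?_
  · exact Φ.rep_apply g (fun i => ((ε i : ℤ) : ℝ)) i
  push_cast
  rfl

theorem conj_smul_mem_posRegions (R : Φ.rep.Regions) :
    conj K • R ∈ Φ.rep.posRegions ↔ R ∉ Φ.rep.posRegions := by
  obtain ⟨ε, rfl⟩ := signRegion_surjective _ R
  have h : Φ.decomp.symm (Φ.φ 0 * conj K) = (-1, 0) := by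
    rw [conj_comm, ← signConj_neg_one, Φ.decomp_symm_mul, Φ.decomp_symm_φ, mul_one]
  rw [smul_signRegion, signRegion_mem_posRegions, signRegion_mem_posRegions,
    NumberedCMType.sgn, NumberedCMType.idx, h]
  rcases Int.units_eq_one_or (ε 0) with h | h <;> simp [h]

/-- Regions correspond to CM-types: the condition `g • R ∈ R(2^m)⁺` on `g ∈ G` defines a CM-type on
`K`, and every CM-type on `K`, given as a set `u` of elements of `G`, arises in this way. -/
theorem exists_region (u : Gal(K/ℚ) → Prop) (hu : ∀ g, u (conj K * g) ↔ ¬ u g) :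
    ∃ R : Φ.rep.Regions, ∀ g, g • R ∈ Φ.rep.posRegions ↔ u g := by
  classical
  -- The first coordinate of `g • ε` is the sign of `φ₀ g` times the entry of `ε` at its index, so the
  -- entries of `ε` are the values of `u` at the elements `φ₀⁻¹ φ_i`.
  refine ⟨signRegion Φ.rep fun i => if u ((Φ.φ 0)⁻¹ * Φ.φ i) then 1 else -1, fun g => ?_⟩
  rw [smul_signRegion, signRegion_mem_posRegions]
  have h1 : g = signConj K (Φ.sgn g 0) * ((Φ.φ 0)⁻¹ * Φ.φ (Φ.idx g 0)) := by
    have h2 := Φ.φ_mul g 0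
    have h3 : signConj K (Φ.sgn g 0) * (Φ.φ 0)⁻¹ = (Φ.φ 0)⁻¹ * signConj K (Φ.sgn g 0) := by
      rcases Int.units_eq_one_or (Φ.sgn g 0) with h | h <;> rw [h]
      · simp
      · rw [signConj_neg_one, conj_comm]
    rw [← mul_assoc, h3, mul_assoc, ← h2, inv_mul_cancel_left]
  conv_rhs => rw [h1]
  rcases Int.units_eq_one_or (Φ.sgn g 0) with h | h <;> rw [h]
  · rw [map_one, one_mul, one_mul]
    split_ifs with h4 <;> simp [h4]
  · rw [signConj_neg_one, hu]
    split_ifs with h4 <;> simp [h4]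

end Regions

/-! ### Simple CM abelian varieties -/

section CM

variable {V : Type*} [AddCommGroup V] [Module ℂ V] {Λ : Submodule ℤ V}

/-- The action of `End⁰(V / Λ)` on `V`. -/
def endAction (Λ : Submodule ℤ V) : EndAlg Λ →+* Module.End ℂ V :=
  (Algebra.TensorProduct.lift
    ((algebraMap ℂ (Module.End ℂ V)).comp (Rat.castHom ℂ)).toIntAlgHom
    (endRing Λ).subtype.toIntAlgHom
    (fun q f => Algebra.commutes (R := ℂ) (q : ℂ) (f : Module.End ℂ V)) :
      ℚ ⊗[ℤ] endRing Λ →ₐ[ℤ] Module.End ℂ V)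

theorem endAction_tmul (q : ℚ) (f : endRing Λ) (v : V) :
    endAction Λ (q ⊗ₜ f) v = (q : ℂ) • f.1 v := rfl

theorem endAction_smul (q : ℚ) (d : EndAlg Λ) (v : V) :
    endAction Λ (q • d) v = (q : ℂ) • endAction Λ d v := by
  rw [show q • d = (q ⊗ₜ[ℤ] (1 : endRing Λ)) * d by
    induction d using TensorProduct.induction_on with
    | zero => simp
    | tmul r f => simp [TensorProduct.smul_tmul']
    | add x y hx hy => rw [smul_add, hx, hy, mul_add], map_mul, Module.End.mul_apply,
    endAction_tmul]
  rfl

/-- A multiple of every element of `End⁰(V / Λ)` belongs to `End(V / Λ)`. -/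
theorem exists_smul_eq_tmul (d : EndAlg Λ) :
    ∃ N : ℕ, 0 < N ∧ ∃ f : endRing Λ, (N : ℚ) • d = 1 ⊗ₜ f := by
  induction d using TensorProduct.induction_on with
  | zero => exact ⟨1, one_pos, 0, by simp⟩
  | tmul q f =>
    refine ⟨q.den, q.den_pos, q.num • f, ?_⟩
    rw [TensorProduct.smul_tmul', smul_eq_mul, Rat.den_mul_eq_num, ← TensorProduct.smul_tmul]
    simp
  | add x y hx hy =>
    obtain ⟨N, hN, f, hf⟩ := hx
    obtain ⟨M, hM, g, hg⟩ := hy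
    refine ⟨N * M, Nat.mul_pos hN hM, M • f + N • g, ?_⟩
    rw [TensorProduct.tmul_add, TensorProduct.tmul_smul, TensorProduct.tmul_smul, ← hf, ← hg]
    simp only [← Nat.cast_smul_eq_nsmul ℚ, smul_smul, smul_add, Nat.cast_mul]
    rw [mul_comm (M : ℚ) N]

/-- Nonzero elements of the endomorphism algebra of a simple abelian variety act injectively. -/
theorem IsAbelianVariety.endAction_injective (h : IsAbelianVariety Λ) (hs : IsSimple Λ)
    {d : EndAlg Λ} (hd : d ≠ 0) : Function.Injective (endAction Λ d) := by
  obtain ⟨N, hN, f, hf⟩ := exists_smul_eq_tmul d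
  have hN' : (N : ℚ) ≠ 0 := by exact_mod_cast hN.ne'
  have hf0 : f.1 ≠ 0 := by
    intro h0
    have h1 : f = 0 := Subtype.ext h0
    rw [h1, TensorProduct.tmul_zero] at hf
    exact hd (by rw [← one_smul ℚ d, ← inv_mul_cancel₀ hN', mul_smul, hf, smul_zero])
  have hinj := h.injective_of_ne_zero hs h.isLattice f.1 f.2 hf0
  have key : ∀ v, f.1 v = (N : ℂ) • endAction Λ d v := by
    intro v
    have h1 := endAction_smul (N : ℚ) d v
    rw [hf, endAction_tmul] at h1
    simpa using h1
  intro v w hvw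
  apply hinj
  rw [key, key, hvw]

/-- If `V / Λ` is simple, `End⁰(V / Λ)` embeds in `Λ ⊗ ℚ` by its action on a lattice vector. -/
theorem IsAbelianVariety.exists_coordinates (h : IsAbelianVariety Λ) (hs : IsSimple Λ) {n : ℕ}
    (b : Module.Basis (Fin n) ℝ V) (hb : Λ = Submodule.span ℤ (Set.range b)) {v₀ : V}
    (hv₀ : v₀ ∈ Λ) (hv₀0 : v₀ ≠ 0) :
    ∃ T : EndAlg Λ →ₗ[ℚ] (Fin n → ℚ), Function.Injective T ∧
      ∀ d, endAction Λ d v₀ = ∑ k, (T d k : ℝ) • b k := by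
  have hex : ∀ d : EndAlg Λ, ∃ q : Fin n → ℚ, endAction Λ d v₀ = ∑ k, (q k : ℝ) • b k := by
    intro d
    obtain ⟨N, hN, f, hf⟩ := exists_smul_eq_tmul d
    have hN' : (N : ℝ) ≠ 0 := by exact_mod_cast hN.ne'
    have h1 := endAction_smul (N : ℚ) d v₀
    rw [hf, endAction_tmul] at h1
    have h2 : f.1 v₀ ∈ Submodule.span ℤ (Set.range b) := hb ▸ f.2 v₀ hv₀
    obtain ⟨a, ha⟩ := (Submodule.mem_span_range_iff_exists_fun ℤ).1 h2
    refine ⟨fun k => a k / N, ?_⟩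
    have h3 : (N : ℝ) • endAction Λ d v₀ = ∑ k, a k • b k := by
      rw [ha]
      have h4 : (N : ℝ) • endAction Λ d v₀ = (N : ℂ) • endAction Λ d v₀ := by
        rw [Nat.cast_smul_eq_nsmul, Nat.cast_smul_eq_nsmul]
      rw [h4]
      simpa using h1.symm
    apply smul_right_injective V hN'
    change (N : ℝ) • _ = (N : ℝ) • _
    rw [h3, Finset.smul_sum]
    refine Finset.sum_congr rfl fun k _ => ?_
    rw [smul_smul, ← Int.cast_smul_eq_zsmul ℝ]
    congr 1
    push_cast
    field_simp
  choose q hq using hex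
  have huniq : ∀ x y : Fin n → ℚ, ∑ k, (x k : ℝ) • b k = ∑ k, (y k : ℝ) • b k → x = y := by
    intro x y hxy
    funext k
    have := congrArg (fun v => b.repr v k) hxy
    simpa only [b.repr_sum_self, Rat.cast_inj] using this
  let T : EndAlg Λ →ₗ[ℚ] (Fin n → ℚ) :=
    { toFun := q
      map_add' := fun x y => huniq _ _ (by
        rw [← hq, map_add, LinearMap.add_apply, hq, hq, ← Finset.sum_add_distrib]
        refine Finset.sum_congr rfl fun k _ => ?_
        rw [Pi.add_apply, Rat.cast_add, add_smul])
      map_smul' := fun r x => huniq _ _ (by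
        rw [← hq, endAction_smul, hq,
          show ((r : ℚ) : ℂ) = (((r : ℝ)) : ℂ) by simp, Complex.coe_smul, Finset.smul_sum]
        refine Finset.sum_congr rfl fun k _ => ?_
        rw [RingHom.id_apply, Pi.smul_apply, smul_eq_mul, Rat.cast_mul, mul_smul]) }
  refine ⟨T, ?_, hq⟩
  rw [injective_iff_map_eq_zero]
  intro d hd
  by_contra hd0
  have h1 : endAction Λ d v₀ = 0 := by
    rw [hq d, show q d = 0 from hd]
    simp
  exact hv₀0 (h.endAction_injective hs hd0 (h1.trans (map_zero _).symm))

/-- If `V / Λ` is simple, a commutative subalgebra `E` of degree `2 dim V` of `End⁰(V / Λ)` is the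
whole of it, and `Λ ⊗ ℚ` is free of rank one over `E`. -/
theorem IsAbelianVariety.exists_generator (h : IsAbelianVariety Λ) (hs : IsSimple Λ) {n : ℕ}
    (b : Module.Basis (Fin n) ℝ V) (hb : Λ = Submodule.span ℤ (Set.range b))
    {E : Type*} [CommRing E] [Algebra ℚ E] (hE : Module.finrank ℚ E = 2 * Module.finrank ℂ V)
    (i : E →ₐ[ℚ] EndAlg Λ) (hi : Function.Injective i) :
    Function.Surjective i ∧ ∃ (v₀ : V) (e : Module.Basis (Fin n) ℚ E),
      v₀ ≠ 0 ∧ ∀ k, endAction Λ (i (e k)) v₀ = b k := by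
  have hn : n = 2 * Module.finrank ℂ V := by
    rw [← finrank_real_of_complex, Module.finrank_eq_card_basis b, Fintype.card_fin]
  have := hs.1
  obtain ⟨k₀⟩ : Nonempty (Fin n) := b.index_nonempty
  obtain ⟨T, hT, hTb⟩ := h.exists_coordinates hs b hb
    (hb ▸ Submodule.subset_span ⟨k₀, rfl⟩) (b.ne_zero k₀)
  let Ti : E →ₗ[ℚ] (Fin n → ℚ) := T ∘ₗ i.toLinearMap
  have hTi : Function.Injective Ti := hT.comp hi
  have := FiniteDimensional.of_injective Ti hTi
  have hTi' : Function.Surjective Ti := by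
    rw [← LinearMap.injective_iff_surjective_of_finrank_eq_finrank]
    · exact hTi
    · rw [hE, ← hn, Module.finrank_fin_fun]
  refine ⟨fun d => ?_, b k₀, Module.Basis.ofEquivFun (LinearEquiv.ofBijective Ti ⟨hTi, hTi'⟩),
    b.ne_zero k₀, fun k => ?_⟩
  · obtain ⟨x, hx⟩ := hTi' (T d)
    exact ⟨x, hT hx⟩
  · rw [hTb]
    have h1 : ∀ l, T (i (Module.Basis.ofEquivFun (LinearEquiv.ofBijective Ti ⟨hTi, hTi'⟩) k)) l =
        (Pi.single k 1 : Fin n → ℚ) l := by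
      intro l
      rw [Module.Basis.coe_ofEquivFun]
      exact congrFun ((LinearEquiv.ofBijective Ti ⟨hTi, hTi'⟩).apply_symm_apply _) l
    simp only [h1]
    rw [Finset.sum_eq_single k]
    · simp
    · intro l _ hl
      simp [hl]
    · simp

/-- If a commutative endomorphism algebra becomes a product of matrix algebras over `K`, the
matrices have size at most one, and a projection gives an embedding in `K`. -/
theorem IsSplitBy.exists_algHom {K : Type*} [Field K] [Algebra ℚ K] (hK : IsSplitBy K Λ)
    {E : Type*} [CommRing E] [Nontrivial E] [Algebra ℚ E] (i : E →ₐ[ℚ] EndAlg Λ)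
    (hi : Function.Bijective i) : Nonempty (E →ₐ[ℚ] K) := by
  obtain ⟨r, n, ⟨φ⟩⟩ := hK
  let ψ : K ⊗[ℚ] E ≃ₐ[K] ((j : Fin r) → Matrix (Fin (n j)) (Fin (n j)) K) :=
    (Algebra.TensorProduct.congr AlgEquiv.refl (AlgEquiv.ofBijective i hi)).trans φ
  have hcomm : ∀ x y : (j : Fin r) → Matrix (Fin (n j)) (Fin (n j)) K, x * y = y * x := by
    intro x y
    obtain ⟨x, rfl⟩ := ψ.surjective x
    obtain ⟨y, rfl⟩ := ψ.surjective y
    rw [← map_mul, mul_comm, map_mul]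
  have hne : ∃ j, 0 < n j := by
    by_contra! hall
    have : ∀ j, IsEmpty (Fin (n j)) := fun j => by
      rw [Nat.le_zero.1 (hall j)]
      infer_instance
    have : Subsingleton (K ⊗[ℚ] E) := ψ.toEquiv.subsingleton
    exact not_subsingleton (K ⊗[ℚ] E) this
  obtain ⟨j, hj⟩ := hne
  have hone : n j = 1 := by
    by_contra hne
    -- For larger matrices the matrix units `E_{pq}` and `E_{qp}` do not commute.
    let p : Fin (n j) := ⟨0, hj⟩
    let q : Fin (n j) := ⟨1, by omega⟩
    have hpq : p ≠ q := by simp [p, q, Fin.ext_iff]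
    have h1 := congrFun (hcomm (Pi.single j (Matrix.single p q 1))
      (Pi.single j (Matrix.single q p 1))) j
    rw [Pi.mul_apply, Pi.mul_apply, Pi.single_eq_same, Pi.single_eq_same] at h1
    have h2 := congrFun (congrFun h1 p) p
    simp [hpq] at h2
  have : Subsingleton (Fin (n j)) := by
    rw [hone]
    infer_instance
  let p : Fin (n j) := ⟨0, hj⟩
  let π : Matrix (Fin (n j)) (Fin (n j)) K →ₐ[K] K :=
    AlgHom.ofLinearMap (Matrix.entryLinearMap K K p p) (by simp) fun x y => by
      simp [Matrix.mul_apply, Fintype.sum_subsingleton _ p]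
  let ev := Pi.evalAlgHom K (fun j => Matrix (Fin (n j)) (Fin (n j)) K) j
  exact ⟨(((π.comp ev).comp ψ.toAlgHom).restrictScalars ℚ).comp
    Algebra.TensorProduct.includeRight⟩

end CM

/-! ### The CM-type of a simple CM abelian variety -/

section CMTypes

variable {V : Type*} [AddCommGroup V] [Module ℂ V] {n : ℕ} {E : Type*} [CommRing E] [Algebra ℚ E]

/-- The real linear form on `V` which corresponds to the homomorphism `ψ : E → ℂ`, when `e` is a
basis of `E` and the real basis `b` of `V` consists of the vectors `e k • v₀` for some `v₀`. It
sends `x • v₀` to `ψ x` for all `x` in `E`. -/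
def eigenform (b : Module.Basis (Fin n) ℝ V) (e : Module.Basis (Fin n) ℚ E) (ψ : E →ₐ[ℚ] ℂ) :
    V →ₗ[ℝ] ℂ :=
  b.constr ℝ fun k => ψ (e k)

variable (b : Module.Basis (Fin n) ℝ V) (e : Module.Basis (Fin n) ℚ E) (ψ : E →ₐ[ℚ] ℂ)

theorem eigenform_basis (k : Fin n) : eigenform b e ψ (b k) = ψ (e k) :=
  b.constr_basis ℝ _ k

theorem eigenform_conj {ψ' : E →ₐ[ℚ] ℂ} (h : ∀ x, ψ' x = (starRingEnd ℂ) (ψ x)) (v : V) :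
    eigenform b e ψ' v = (starRingEnd ℂ) (eigenform b e ψ v) := by
  have : eigenform b e ψ' = Complex.conjAe.toLinearMap ∘ₗ eigenform b e ψ := by
    refine b.ext fun k => ?_
    simp [eigenform_basis, h]
  rw [this]
  rfl

section

variable {b e} {A : E →+* Module.End ℂ V} {v₀ : V}
  (hA : ∀ (q : ℚ) (x : E) (v : V), A (q • x) v = (q : ℂ) • A x v)
  (hb : ∀ k, A (e k) v₀ = b k)
include hA hb

theorem eigenform_apply_generator (x : E) : eigenform b e ψ (A x v₀) = ψ x := by
  conv_lhs => rw [← e.sum_repr x]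
  conv_rhs => rw [← e.sum_repr x]
  rw [map_sum, LinearMap.sum_apply, map_sum, map_sum]
  refine Finset.sum_congr rfl fun k _ => ?_
  rw [hA, hb, show ((e.repr x k : ℚ) : ℂ) = ((e.repr x k : ℝ) : ℂ) by simp, Complex.coe_smul,
    map_smul, map_smul, eigenform_basis, Complex.real_smul,
    Algebra.smul_def]
  simp

theorem eigenform_apply (x : E) (v : V) :
    eigenform b e ψ (A x v) = ψ x * eigenform b e ψ v := by
  have : eigenform b e ψ ∘ₗ (A x).restrictScalars ℝ =
      LinearMap.mulLeft ℝ (ψ x) ∘ₗ eigenform b e ψ := by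
    refine b.ext fun k => ?_
    change eigenform b e ψ (A x (b k)) = ψ x * eigenform b e ψ (b k)
    rw [← hb, ← Module.End.mul_apply, ← map_mul, eigenform_apply_generator ψ hA hb,
      eigenform_apply_generator ψ hA hb, map_mul]
  exact LinearMap.congr_fun this v

theorem eigenform_generator : eigenform b e ψ v₀ = 1 := by
  have := eigenform_apply_generator ψ hA hb 1
  simpa using this

/-- Multiplication by `i` on `V` commutes with `E`, so it multiplies an eigenform by a constant,
whose square is `-1`. -/
theorem eigenform_I_smul :
    (∀ v, eigenform b e ψ (Complex.I • v) = Complex.I * eigenform b e ψ v) ∨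
      (∀ v, eigenform b e ψ (Complex.I • v) = -Complex.I * eigenform b e ψ v) := by
  set c := eigenform b e ψ (Complex.I • v₀) with hc
  have h1 : ∀ v, eigenform b e ψ (Complex.I • v) = c * eigenform b e ψ v := by
    intro v
    have : eigenform b e ψ ∘ₗ
        (LinearMap.lsmul ℂ V Complex.I).restrictScalars ℝ =
        LinearMap.mulLeft ℝ c ∘ₗ eigenform b e ψ := by
      refine b.ext fun k => ?_
      change eigenform b e ψ (Complex.I • b k) = c * eigenform b e ψ (b k)
      rw [← hb, ← map_smul, eigenform_apply ψ hA hb, eigenform_apply_generator ψ hA hb, mul_comm]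
    exact LinearMap.congr_fun this v
  -- Apply the form to `i (i v₀) = -v₀`.
  have h2 : c * c = -1 := by
    rw [← eigenform_generator ψ hA hb, ← map_neg, hc, ← h1, smul_smul, Complex.I_mul_I, neg_smul,
      one_smul]
  have h3 : (c - Complex.I) * (c + Complex.I) = 0 := by
    linear_combination h2 - Complex.I_mul_I
  rcases mul_eq_zero.1 h3 with h | h
  · left
    rwa [sub_eq_zero.1 h] at h1
  · right
    rwa [eq_neg_of_add_eq_zero_left h] at h1

/-- Exactly one of two complex conjugate homomorphisms `E → ℂ` belongs to the CM-type of `V`. -/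
theorem eigenform_I_smul_conj {ψ' : E →ₐ[ℚ] ℂ} (h : ∀ x, ψ' x = (starRingEnd ℂ) (ψ x)) :
    (∀ v, eigenform b e ψ' (Complex.I • v) = Complex.I * eigenform b e ψ' v) ↔
      ¬ ∀ v, eigenform b e ψ (Complex.I • v) = Complex.I * eigenform b e ψ v := by
  simp only [eigenform_conj b e ψ h]
  constructor
  · intro h1 h2
    have h3 := h1 v₀
    rw [h2, map_mul, eigenform_generator ψ hA hb, Complex.conj_I] at h3
    have := congrArg Complex.im h3
    norm_num at this
  · intro h1 v
    rw [(eigenform_I_smul ψ hA hb).resolve_left h1 v, map_mul, map_neg, Complex.conj_I, neg_neg]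

end

end CMTypes

/-! ### Mapping a simple CM abelian variety to `A(S, S⁺)` -/

/-- Finitely many vectors can be moved into a rational lattice by a positive integer. -/
theorem IsLattice.exists_pos_smul_mem {M : Type*} [AddCommGroup M] [Module ℚ M]
    {L : Submodule ℤ M} (hL : IsLattice ℚ L) {κ : Type*} [Finite κ] (x : κ → M) :
    ∃ N : ℕ, 0 < N ∧ ∀ k, N • x k ∈ L := by
  have := Fintype.ofFinite κ
  obtain ⟨n, b, rfl⟩ := hL
  have hone : ∀ y : M, ∃ N : ℕ, 0 < N ∧ N • y ∈ Submodule.span ℤ (Set.range b) := by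
    intro y
    refine ⟨∏ k, (b.repr y k).den, Finset.prod_pos fun k _ => (b.repr y k).den_pos, ?_⟩
    conv => enter [2, 2]; rw [← b.sum_repr y]
    rw [Finset.smul_sum]
    refine Submodule.sum_mem _ fun k _ => ?_
    obtain ⟨c, hc⟩ := Finset.dvd_prod_of_mem (fun k => (b.repr y k).den) (Finset.mem_univ k)
    rw [hc, mul_comm, mul_smul, ← Nat.cast_smul_eq_nsmul ℚ (b.repr y k).den, smul_smul,
      Rat.den_mul_eq_num, Int.cast_smul_eq_zsmul]
    exact nsmul_mem (Submodule.smul_mem _ _ (Submodule.subset_span (Set.mem_range_self k))) _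
  choose N hN hx using fun k => hone (x k)
  refine ⟨∏ k, N k, Finset.prod_pos fun k _ => hN k, fun k => ?_⟩
  obtain ⟨c, hc⟩ := Finset.dvd_prod_of_mem N (Finset.mem_univ k)
  rw [hc, mul_comm, mul_smul]
  exact nsmul_mem (hx k) _

/-- An `ℝ`-linear map which commutes with multiplication by `i` is `ℂ`-linear. -/
theorem map_complex_smul_of_I {V W : Type*} [AddCommGroup V] [Module ℂ V] [AddCommGroup W]
    [Module ℂ W] (f : V →ₗ[ℝ] W) (hf : ∀ v, f (Complex.I • v) = Complex.I • f v) (c : ℂ) (v : V) :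
    f (c • v) = c • f v := by
  conv_lhs => rw [← Complex.re_add_im c]
  conv_rhs => rw [← Complex.re_add_im c]
  rw [add_smul, add_smul, mul_smul, mul_smul, Complex.coe_smul,
    Complex.coe_smul, Complex.coe_smul, Complex.coe_smul, map_add, map_smul, map_smul, hf]

section Main

variable {K : IntermediateField ℚ ℂ} [FiniteDimensional ℚ K] [NumberField.IsCMField K]
variable {S : Type*} [MulAction Gal(K/ℚ) S] {Splus : Set S}

/-- If every CM-type on `K` comes from an element of `S`, every simple CM abelian variety split
by `K` is isogenous to an abelian subvariety of `A(S, S⁺)`. The homomorphism is the map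
`v ↦ (∑ λ_{g ∘ j} v)_s`, where `j` embeds the endomorphism algebra in `K`, where `λ_ψ` is the
eigenform of `ψ`, and where the sum is over the `g` which send to `s` the element of `S` whose
CM-type is that of the variety. -/
theorem exists_isogenous_subvariety [IsGalois ℚ K] [Finite S]
    (hS : ∀ s, conj K • s ∈ Splus ↔ s ∉ Splus)
    (hex : ∀ u : Gal(K/ℚ) → Prop, (∀ g, u (conj K * g) ↔ ¬ u g) →
      ∃ s : S, ∀ g : Gal(K/ℚ), g • s ∈ Splus ↔ u g)
    {L : Submodule ℤ (equivariantMaps K S)} (hL : IsLattice ℚ L)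
    {V : Type*} [AddCommGroup V] [Module ℂ V] {Λ : Submodule ℤ V} (h : IsAbelianVariety Λ)
    (hs : IsSimple Λ) (hCM : IsCM Λ) (hK : IsSplitBy K Λ) :
    ∃ W : Submodule ℂ (Splus → ℂ), IsAbelianSubvariety (pairLattice Splus L) W ∧
      Isogenous Λ (subLattice (pairLattice Splus L) W) := by
  classical
  obtain ⟨E, _, _, -, hdim, i, hi⟩ := hCM
  obtain ⟨n, b, hb⟩ := h.isLattice
  obtain ⟨hi', v₀, e, hv₀, he⟩ := h.exists_generator hs b hb hdim i hi
  have hA : ∀ (q : ℚ) (x : E) (v : V), ((endAction Λ).comp (i : E →+* EndAlg Λ)) (q • x) v =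
      (q : ℂ) • ((endAction Λ).comp (i : E →+* EndAlg Λ)) x v := fun q x v => by
    change endAction Λ (i (q • x)) v = _
    rw [map_smul, endAction_smul]
    rfl
  have : Nontrivial E := by
    have := hs.1
    obtain ⟨k₀⟩ : Nonempty (Fin n) := b.index_nonempty
    exact ⟨e k₀, 0, e.ne_zero k₀⟩
  obtain ⟨j⟩ := hK.exists_algHom i ⟨hi, hi'⟩
  let ψ : Gal(K/ℚ) → (E →ₐ[ℚ] ℂ) := fun g => (K.val.comp g.toAlgHom).comp j
  have hψ : ∀ g x, ψ g x = (g (j x) : ℂ) := fun _ _ => rfl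
  let lam : Gal(K/ℚ) → (V →ₗ[ℝ] ℂ) := fun g => eigenform b e (ψ g)
  have hlam1 : ∀ g, lam g v₀ = 1 := fun g => eigenform_generator (ψ g) hA he
  -- `t` is the element of `S` attached to the CM-type of `V`.
  obtain ⟨t, ht⟩ := hex (fun g => ∀ v, lam g (Complex.I • v) = Complex.I * lam g v) fun g =>
    eigenform_I_smul_conj (ψ g) hA he fun x => coe_conj K (g (j x))
  obtain ⟨N, hN, hNL⟩ := hL.exists_pos_smul_mem fun k => orbitSum t (j (e k))
  let f₀ : V →ₗ[ℝ] (Splus → ℂ) :=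
    LinearMap.pi fun s => ∑ g : Gal(K/ℚ), if g • t = (s : S) then lam g else 0
  have hf₀ : ∀ v s, f₀ v s = ∑ g : Gal(K/ℚ), if g • t = (s : S) then lam g v else 0 := by
    intro v s
    simp only [f₀, LinearMap.pi_apply, LinearMap.sum_apply]
    refine Finset.sum_congr rfl fun g _ => ?_
    split_ifs <;> rfl
  have hI : ∀ v, f₀ (Complex.I • v) = Complex.I • f₀ v := by
    intro v
    funext s
    rw [Pi.smul_apply, hf₀, hf₀, Finset.smul_sum]
    refine Finset.sum_congr rfl fun g _ => ?_
    split_ifs with hg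
    · exact (ht g).1 (hg ▸ s.2) v
    · exact (smul_zero _).symm
  let f₁ : V →ₗ[ℂ] (Splus → ℂ) :=
    { toFun := f₀, map_add' := map_add f₀, map_smul' := map_complex_smul_of_I f₀ hI }
  have hbasis : ∀ k, f₁ (b k) = evalPos Splus (orbitSum t (j (e k))) := by
    intro k
    funext s
    refine (hf₀ _ _).trans ?_
    rw [evalPos_apply, orbitSum_apply, AddSubmonoidClass.coe_finsetSum]
    refine Finset.sum_congr rfl fun g _ => ?_
    split_ifs
    · rw [eigenform_basis, hψ]
    · rfl
  have hne : f₁ ≠ 0 := by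
    intro h0
    -- At `v₀`, a component counts the `g` in its sum.
    obtain ⟨g, hg⟩ : ∃ g : Gal(K/ℚ), g • t ∈ Splus := by
      by_cases h1 : t ∈ Splus
      · exact ⟨1, by rwa [one_smul]⟩
      · exact ⟨conj K, (hS t).2 h1⟩
    have h1 : f₀ v₀ ⟨g • t, hg⟩ = 0 := congrFun (LinearMap.congr_fun h0 v₀) _
    rw [hf₀] at h1
    simp only [hlam1, Finset.sum_boole, Nat.cast_eq_zero, Finset.card_eq_zero] at h1
    exact Finset.notMem_empty g (h1 ▸ Finset.mem_filter.2 ⟨Finset.mem_univ g, rfl⟩)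
  have hA' := isAbelianVariety_pairLattice hS hL
  have hmaps : ∀ x ∈ Λ, (N • f₁) x ∈ pairLattice Splus L := by
    rw [hb]
    intro x hx
    induction hx using Submodule.span_induction with
    | mem x hx =>
      obtain ⟨k, rfl⟩ := hx
      rw [LinearMap.smul_apply, hbasis, ← map_nsmul]
      exact ⟨_, hNL k, rfl⟩
    | zero => rw [map_zero]; exact Submodule.zero_mem _
    | add x y _ _ hx hy => rw [map_add]; exact Submodule.add_mem _ hx hy
    | smul a x _ hx => rw [map_zsmul]; exact Submodule.smul_mem _ _ hx
  have hne' : N • f₁ ≠ 0 := smul_ne_zero hN.ne' hne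
  exact ⟨_, h.isogenous_range hA' (N • f₁) hmaps
    (h.injective_of_ne_zero hs hA'.isLattice _ hmaps hne')⟩

end Main

end CMArrangement

end

open CMArrangement
theorem mainTheorem3 (K : IntermediateField ℚ ℂ) [FiniteDimensional ℚ K] [IsGalois ℚ K]
    [NumberField.IsCMField K] (m : ℕ) [NeZero m] (Φ : NumberedCMType K m)
    (L : Submodule ℤ (equivariantMaps K Φ.rep.Regions)) (hL : IsLattice ℚ L) :
    IsAbelianVariety (arrangementLattice Φ.rep L) ∧
      ∀ (V : Type*) [AddCommGroup V] [Module ℂ V] (Λ : Submodule ℤ V),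
        IsAbelianVariety Λ → IsSimple Λ → IsCM Λ → IsSplitBy K Λ →
          ∃ W : Submodule ℂ (Φ.rep.posRegions → ℂ),
            IsAbelianSubvariety (arrangementLattice Φ.rep L) W ∧
              Isogenous Λ (subLattice (arrangementLattice Φ.rep L) W) :=
  ⟨isAbelianVariety_pairLattice (conj_smul_mem_posRegions Φ) hL,
    fun _ _ _ _ h hs hCM hK => exists_isogenous_subvariety (conj_smul_mem_posRegions Φ)
      (exists_region Φ) hL h hs hCM hK⟩
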